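/- **Proposition (Linear index-2 components).** Let $\mathcal I=[t_0,t_1]$ with $t_0<t_1$; all functions below are $C^\infty$. *DAEs.* For a DAE $\mathbf F(\mathbf x',\mathbf x,t)=0$, $t\in\mathcal I$, say that an equation $\mathbf E(\mathbf x',\mathbf x,t)=0$ is obtained after $m$ differentiations by algebraic manipulations if, identically in $t\in\mathcal I$ and in $\mathbf x,\mathbf x',\dots,\mathbf x^{(m+1)}$ as independent variables, $\mathbf E=\sum_{j=0}^m \mathbf R_j\,\frac{\mathrm d^j}{\mathrm dt^j}\mathbf F$ with matrices $\mathbf R_j$ depending smoothly on $t,\mathbf x,\mathbf x',\dots,\mathbf x^{(m+1)}$. For a linear map $\ell$, the component $\ell\mathbf x$ is determined after $m$ differentiations if some equation $\ell\mathbf x'=\Phi(\mathbf x,t)$ with $\Phi$ continuous is so obtained; the differential index is the least $m$ for which $\mathbf x$ itself is determined after $m$ differentiations. The DAE has *linear index-2 components* $\mathbf T\mathbf x$, $\mathbf T$ a projector, if (a) its differential index is $2$; (b) for each linear functional $\ell$, the component $\ell\mathbf x$ is determined after one differentiation if and only if $\ell\mathbf T=0$; (c) there is a constant matrix $\mathbf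 M$ with $\mathbf F(\mathbf x',\mathbf x,t)=\mathbf F((\mathbf I-\mathbf T)\mathbf x',(\mathbf I-\mathbf T)\mathbf x,t)+\mathbf M\mathbf T\mathbf x$ for all $\mathbf x',\mathbf x$ and $t\in\mathcal I$. *Circuit.* Consider a circuit, given as a finite directed graph with a ground node whose branches are capacitors (C), resistors (R), inductors (L), voltage sources (V), current sources (I) and branches of one generalised element ($\lambda$). Let $\mathbf A_\star$ be the columns of the reduced incidence matrix (ground row deleted) of the branches of kind $\star$. Assume $\ker(\mathbf A_R\ \mathbf A_C\ \mathbf A_V\ \mathbf A_L\ \mathbf A_\lambda)^\top=\{0\}$, $\ker\mathbf A_V=\{0\}$, and that $\partial\mathbf g/\partial\mathbf v_R$, $\partial\phi_L/\partial\mathbf i_L$, $\partial\mathbf q/\partial\mathbf v_C$ are positive definite (not necessarily symmetric) for all arguments and all $t\in\mathcal I$. *Element.* Let the generalised element be inductance-like: it is described by a DAE $\mathbf F(\mathbf x_\lambda',\mathbf i_\lambda',\mathbf x_\lambda,\mathbf i_\lambda,\mathbf v_\lambda,t)=0$ of $n_{\mathrm{dof}}+n_\lambda$ equations, with $\mathbf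 x_\lambda\in\mathbb R^{n_{\mathrm{dof}}}$ and $\mathbf i_\lambda,\mathbf v_\lambda\in\mathbb R^{n_\lambda}$, from which after at most one differentiation one obtains, by algebraic manipulations, a system $\mathbf x_\lambda'=\mathbf f_x(\mathbf x_\lambda,\mathbf i_\lambda,\mathbf v_\lambda,t)$, $\frac{\mathrm d}{\mathrm dt}\phi(\mathbf i_\lambda,\mathbf x_\lambda,t)=\mathbf f_\phi(\mathbf x_\lambda,\mathbf i_\lambda,\mathbf v_\lambda,t)$ such that $\partial\phi/\partial\mathbf i_\lambda$ is regular and $\frac{\partial}{\partial\mathbf v_\lambda}\Big(\big(\tfrac{\partial\phi}{\partial\mathbf i_\lambda}\big)^{-1}\big(-\tfrac{\partial\phi}{\partial\mathbf x_\lambda}\mathbf f_x-\tfrac{\partial\phi}{\partial t}+\mathbf f_\phi\big)\Big)$ is positive definite. Suppose further that the voltage enters linearly, $\mathbf F=\tilde{\mathbf F}(\mathbf x_\lambda',\mathbf i_\lambda',\mathbf x_\lambda,\mathbf i_\lambda,t)+\mathbf B\mathbf v_\lambda$ with a constant matrix $\mathbf B\in\mathbb R^{(n_{\mathrm{dof}}+n_\lambda)\times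 n_\lambda}$. *Coupled system*, with unknowns $(\mathbf e,\mathbf i_L,\mathbf i_V,\mathbf x_\lambda,\mathbf i_\lambda)$: $$\begin{aligned} \mathbf A_C\tfrac{\mathrm d}{\mathrm dt}\mathbf q(\mathbf A_C^\top\mathbf e,t)+\mathbf A_R\mathbf g(\mathbf A_R^\top\mathbf e,t)+\mathbf A_L\mathbf i_L+\mathbf A_V\mathbf i_V+\mathbf A_\lambda\mathbf i_\lambda+\mathbf A_I\mathbf i_{\mathrm{src}}(t)&=0,\\ \tfrac{\mathrm d}{\mathrm dt}\phi_L(\mathbf i_L,t)-\mathbf A_L^\top\mathbf e&=0,\\ \mathbf A_V^\top\mathbf e-\mathbf v_{\mathrm{src}}(t)&=0,\\ \mathbf F(\mathbf x_\lambda',\mathbf i_\lambda',\mathbf x_\lambda,\mathbf i_\lambda,\mathbf A_\lambda^\top\mathbf e,t)&=0. \end{aligned}$$ Assume that this system is consistent, in the sense that at some $t\in\mathcal I$ its equations and their first time derivatives have a common solution (in the unknowns and their first two derivatives as independent variables); this holds whenever the system has a smooth solution. *Claim.* Suppose the element is contained in an LI$\lambda$-cutset: some set of branches, all of kind L, I or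 $\lambda$ and at least one of kind $\lambda$, is such that its deletion disconnects the graph while adding back any one of its branches makes it connected. Let $\mathbf Q_C$ be a projector onto $\ker\mathbf A_C^\top$, $\mathbf Q_{CRV}$ a projector onto $\ker(\mathbf A_C\ \mathbf A_R\ \mathbf A_V)^\top$ and $\bar{\mathbf Q}_{V-C}$ a projector onto $\ker\mathbf Q_C^\top\mathbf A_V$. Then the coupled system has linear index-2 components, namely the node potentials $\mathbf Q_{CRV}\mathbf e$ and the currents $\bar{\mathbf Q}_{V-C}\mathbf i_V$ of voltage sources in CV-loops; that is, the definition above holds with $\mathbf T(\mathbf e,\mathbf i_L,\mathbf i_V,\mathbf x_\lambda,\mathbf i_\lambda)=(\mathbf Q_{CRV}\mathbf e,0,\bar{\mathbf Q}_{V-C}\mathbf i_V,0,0)$. -/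

import Mathlib

open scoped ContDiff Matrix

/-! ## Differential-algebraic equations, derivative arrays, differential index

A DAE `F(x', x, t) = 0` is a function `F : X → X → ℝ → W`, with arguments in the order
`x'`, `x`, `t`.  It is considered for times `t` in a set `I`. -/

section DAE

variable {X W U : Type*} [NormedAddCommGroup X] [NormedSpace ℝ X]
  [NormedAddCommGroup W] [NormedSpace ℝ W] [NormedAddCommGroup U] [NormedSpace ℝ U]

/-- The polynomial curve with `c(t) = u 0`, `c'(t) = u 1`, ..., i.e. with the prescribed jet `u`
at time `t`. -/
noncomputable def jetCurve {n : ℕ} (u : Fin n → X) (t s : ℝ) : X :=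
  ∑ j : Fin n, ((s - t) ^ (j : ℕ) / ((j : ℕ).factorial : ℝ)) • u j

/-- The expression `d^j/dt^j F(x', x, t)`, as a function of the time `t` and of the jet
`(x, x', x'', ...) = (u 0, u 1, u 2, ...)`.  By the chain rule it depends only on the jet of a curve
up to order `j + 1`, so it may be computed along any curve with that jet. -/
noncomputable def totalDeriv (F : X → X → ℝ → W) (j : ℕ) {n : ℕ} (u : Fin n → X) (t : ℝ) : W :=
  iteratedDeriv j (fun s => F (deriv (jetCurve u t) s) (jetCurve u t s) s) t

/-- The equation `E(x', x, t) = 0` can be written down by algebraic manipulations of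
`F = 0, dF/dt = 0, ..., d^m F/dt^m = 0`: identically in `t ∈ I` and in `x, x', x'', ...`, the
expression `E` is a combination of `F, dF/dt, ..., d^m F/dt^m` whose coefficients (linear maps)
are smooth functions of `t, x, x', x'', ...`. -/
def ObtainedBy (I : Set ℝ) (F : X → X → ℝ → W) (m : ℕ) (E : X → X → ℝ → U) : Prop :=
  ∃ R : Fin (m + 1) → (Fin (m + 2) → X) × ℝ → (W →L[ℝ] U),
    (∀ j, ContDiffOn ℝ ∞ (R j) (Set.univ ×ˢ I)) ∧
    ∀ t ∈ I, ∀ u : Fin (m + 2) → X,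
      E (u 1) (u 0) t = ∑ j : Fin (m + 1), R j (u, t) (totalDeriv F j u t)

/-- After `m` differentiations of `F = 0` one can write `(ℓ x)' = Φ(x, t)` with `Φ` continuous:
the derivative of the component `ℓ x` of the solution is determined. -/
def DeterminedAfter (I : Set ℝ) (F : X → X → ℝ → W) (m : ℕ) (ℓ : X →ₗ[ℝ] U) : Prop :=
  ∃ Φ : X × ℝ → U, ContinuousOn Φ (Set.univ ×ˢ I) ∧
    ObtainedBy I F m (fun y x t => ℓ y - Φ (x, t))

/-- `m` is the minimal number of differentiations of `F = 0` after which one can write an ordinary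
differential equation `x' = Φ(x, t)` with `Φ` continuous. -/
def HasDifferentialIndex (I : Set ℝ) (F : X → X → ℝ → W) (m : ℕ) : Prop :=
  IsLeast {k : ℕ | DeterminedAfter I F k (LinearMap.id : X →ₗ[ℝ] X)} m

/-- The equations `F = 0, ..., d^m F/dt^m = 0` have a common solution `(t, x, x', ...)`. -/
def ConsistentToOrder (I : Set ℝ) (F : X → X → ℝ → W) (m : ℕ) : Prop :=
  ∃ t ∈ I, ∃ u : Fin (m + 2) → X, ∀ j ≤ m, totalDeriv F j u t = 0

/-- The DAE has differential index 2 and its index-2 components are `T x`, `T` a projector: the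
derivative of a scalar component `ℓ x` is determined after one differentiation precisely if `ℓ`
does not see `T x`. -/
def HasIndexTwoComponents (I : Set ℝ) (F : X → X → ℝ → W) (T : X →ₗ[ℝ] X) : Prop :=
  T ∘ₗ T = T ∧ HasDifferentialIndex I F 2 ∧
    ∀ ℓ : X →ₗ[ℝ] ℝ, DeterminedAfter I F 1 ℓ ↔ ℓ ∘ₗ T = 0

/-- The DAE has index-2 components `T x`, and these enter the equations linearly, with a constant
coefficient, and without being differentiated:
`F(x', x, t) = F((1 - T) x', (1 - T) x, t) + M T x`. -/
def HasLinearIndexTwoComponents (I : Set ℝ) (F : X → X → ℝ → W) (T : X →ₗ[ℝ] X) : Prop :=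
  HasIndexTwoComponents I F T ∧
    ∃ M : X →ₗ[ℝ] W, ∀ (y x : X), ∀ t ∈ I, F y x t = F (y - T y) (x - T x) t + M (T x)

end DAE

/-- Positive definiteness of a (not necessarily symmetric) operator on `ℝ^ι`. -/
def IsPosDefOp {ι : Type*} [Fintype ι] (A : (ι → ℝ) →L[ℝ] (ι → ℝ)) : Prop :=
  ∀ w : ι → ℝ, w ≠ 0 → 0 < w ⬝ᵥ A w

/-! ## Inductance-like elements -/

section Element

/-- The function `F(x', i', x, i, v, t)` of the DAE of an element with internal unknowns
`x ∈ ℝ^δ`, branch currents `i ∈ ℝ^κ` and branch voltages `v ∈ ℝ^κ`. -/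
abbrev ElementFun (δ κ : Type*) :=
  (δ → ℝ) × (κ → ℝ) × (δ → ℝ) × (κ → ℝ) × (κ → ℝ) × ℝ → (δ ⊕ κ → ℝ)

variable {δ κ : Type*} [Fintype δ] [Fintype κ]

/-- The element equation as a DAE for the triple `(x, i, v)`; `v'` does not occur. -/
def elementDAE (F : ElementFun δ κ) :
    ((δ → ℝ) × (κ → ℝ) × (κ → ℝ)) → ((δ → ℝ) × (κ → ℝ) × (κ → ℝ)) → ℝ → (δ ⊕ κ → ℝ) :=
  fun y z t => F (y.1, y.2.1, z.1, z.2.1, z.2.2, t)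

/-- The system `x' = f_x(x, i, v, t)`, `d/dt φ(i, x, t) = f_φ(x, i, v, t)`, written as left-hand
side minus right-hand side; `d/dt φ(i, x, t)` is expanded by the chain rule. -/
noncomputable def reducedElementDAE (φ : (κ → ℝ) × (δ → ℝ) × ℝ → (κ → ℝ))
    (fx : (δ → ℝ) × (κ → ℝ) × (κ → ℝ) × ℝ → (δ → ℝ))
    (fφ : (δ → ℝ) × (κ → ℝ) × (κ → ℝ) × ℝ → (κ → ℝ)) :
    ((δ → ℝ) × (κ → ℝ) × (κ → ℝ)) → ((δ → ℝ) × (κ → ℝ) × (κ → ℝ)) → ℝ →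
      (δ → ℝ) × (κ → ℝ) :=
  fun y z t =>
    (y.1 - fx (z.1, z.2.1, z.2.2, t),
      fderiv ℝ φ (z.2.1, z.1, t) (y.2.1, y.1, 1) - fφ (z.1, z.2.1, z.2.2, t))

/-- `∂φ/∂i` at `(i, x, t)`. -/
noncomputable def dphi_di (φ : (κ → ℝ) × (δ → ℝ) × ℝ → (κ → ℝ))
    (i : κ → ℝ) (x : δ → ℝ) (t : ℝ) : (κ → ℝ) →L[ℝ] (κ → ℝ) :=
  fderiv ℝ (fun i' => φ (i', x, t)) i

/-- `(∂φ/∂i)⁻¹ (- ∂φ/∂x f_x - ∂φ/∂t + f_φ)` at `(x, i, v, t)`. -/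
noncomputable def currentRate (φ : (κ → ℝ) × (δ → ℝ) × ℝ → (κ → ℝ))
    (fx : (δ → ℝ) × (κ → ℝ) × (κ → ℝ) × ℝ → (δ → ℝ))
    (fφ : (δ → ℝ) × (κ → ℝ) × (κ → ℝ) × ℝ → (κ → ℝ))
    (x : δ → ℝ) (i v : κ → ℝ) (t : ℝ) : κ → ℝ :=
  (dphi_di φ i x t).inverse
    (- fderiv ℝ (fun x' => φ (i, x', t)) x (fx (x, i, v, t))
      - deriv (fun s => φ (i, x, s)) t + fφ (x, i, v, t))

/-- Inductance-like elements. -/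
def IsInductanceLike (I : Set ℝ) (F : ElementFun δ κ) : Prop :=
  ∃ (φ : (κ → ℝ) × (δ → ℝ) × ℝ → (κ → ℝ))
    (fx : (δ → ℝ) × (κ → ℝ) × (κ → ℝ) × ℝ → (δ → ℝ))
    (fφ : (δ → ℝ) × (κ → ℝ) × (κ → ℝ) × ℝ → (κ → ℝ)),
    ContDiff ℝ ∞ φ ∧ ContDiff ℝ ∞ fx ∧ ContDiff ℝ ∞ fφ ∧
    ObtainedBy I (elementDAE F) 1 (reducedElementDAE φ fx fφ) ∧
    (∀ i x, ∀ t ∈ I, (dphi_di φ i x t).IsInvertible) ∧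
    (∀ x i v, ∀ t ∈ I, IsPosDefOp (fderiv ℝ (fun v' => currentRate φ fx fφ x i v' t) v))

end Element

/-! ## Circuits -/

/-- Capacitor, resistor, inductor, voltage source, current source, generalised element. -/
inductive BranchKind
  | C | R | L | V | I | lam
  deriving DecidableEq

/-- A circuit as a directed graph with finite edge set `β`.  The nodes are `some n` for `n : ν` and
the ground node `none`. -/
structure CircuitGraph (ν β : Type*) where
  tail : β → Option ν
  head : β → Option ν
  kind : β → BranchKind

namespace CircuitGraph

variable {ν β : Type*} (G : CircuitGraph ν β)

/-- The branches of a given kind. -/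
abbrev Br (k : BranchKind) : Type _ := {b : β // G.kind b = k}

/-- The columns of the (reduced) incidence matrix that belong to the branches of kind `k`. -/
def A [DecidableEq ν] (k : BranchKind) : Matrix ν (G.Br k) ℝ :=
  fun n b => (if G.tail b.1 = some n then 1 else 0) - (if G.head b.1 = some n then 1 else 0)

/-- The undirected graph on all nodes formed by the branches in `S`. -/
def graphOf (S : Set β) : SimpleGraph (Option ν) :=
  SimpleGraph.fromRel (fun a b => ∃ e ∈ S, G.tail e = a ∧ G.head e = b)

/-- `E` is a cutset: deleting it disconnects the graph, and adding any one of its branches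
to the remaining graph makes that connected again. -/
def IsCutset (E : Set β) : Prop :=
  ¬ (G.graphOf Eᶜ).Connected ∧ ∀ e ∈ E, (G.graphOf (insert e Eᶜ)).Connected

/-- The generalised element is contained in a cutset that consists only of inductors, current
sources and branches of the generalised element. -/
def LiesInLILamCutset : Prop :=
  ∃ E : Set β, G.IsCutset E ∧
    (∀ b ∈ E, G.kind b = .L ∨ G.kind b = .I ∨ G.kind b = .lam) ∧ ∃ b ∈ E, G.kind b = .lam

/-- The kernel of the transpose of the block matrix formed by the `A k`, `k ∈ K`. -/
def nodeKer [DecidableEq ν] [Fintype ν] (K : Set BranchKind) : Submodule ℝ (ν → ℝ) :=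
  ⨅ k ∈ K, LinearMap.ker (G.A k)ᵀ.mulVecLin

end CircuitGraph

/-- The functions of the lumped parameter models: charges `q(v, t)`, conductances `g(v, t)`, fluxes
`φ_L(i, t)`, source currents and source voltages. -/
structure CircuitModel {ν β : Type*} (G : CircuitGraph ν β) where
  q : (G.Br .C → ℝ) × ℝ → (G.Br .C → ℝ)
  g : (G.Br .R → ℝ) × ℝ → (G.Br .R → ℝ)
  φL : (G.Br .L → ℝ) × ℝ → (G.Br .L → ℝ)
  isrc : ℝ → (G.Br .I → ℝ)
  vsrc : ℝ → (G.Br .V → ℝ)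

section Coupled

variable {ν β δ : Type*} [Fintype ν] [DecidableEq ν] [Fintype β] [Fintype δ]

/-- All functions of the circuit model are smooth. -/
def CircuitModel.IsSmooth {G : CircuitGraph ν β} (M : CircuitModel G) : Prop :=
  ContDiff ℝ ∞ M.q ∧ ContDiff ℝ ∞ M.g ∧ ContDiff ℝ ∞ M.φL ∧
    ContDiff ℝ ∞ M.isrc ∧ ContDiff ℝ ∞ M.vsrc

/-- Well-posedness: no cutsets of current sources only, no loops of voltage sources only, and
positive definite conductances `∂g/∂v`, inductances `∂φ_L/∂i` and capacitances `∂q/∂v`. -/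
structure CircuitModel.WellPosed {G : CircuitGraph ν β} (M : CircuitModel G) (I : Set ℝ) :
    Prop where
  no_I_cutset : G.nodeKer {.R, .C, .V, .L, .lam} = ⊥
  no_V_loop : LinearMap.ker (G.A .V).mulVecLin = ⊥
  posDef_G : ∀ v, ∀ t ∈ I, IsPosDefOp (fderiv ℝ (fun v' => M.g (v', t)) v)
  posDef_L : ∀ i, ∀ t ∈ I, IsPosDefOp (fderiv ℝ (fun i' => M.φL (i', t)) i)
  posDef_C : ∀ v, ∀ t ∈ I, IsPosDefOp (fderiv ℝ (fun v' => M.q (v', t)) v)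

/-- The unknowns `(e, i_L, i_V, x_λ, i_λ)` of the coupled system. -/
abbrev CoupledState (G : CircuitGraph ν β) (δ : Type*) :=
  (ν → ℝ) × (G.Br .L → ℝ) × (G.Br .V → ℝ) × (δ → ℝ) × (G.Br .lam → ℝ)

/-- The coupled system: Kirchhoff's current law, the inductor equations, the voltage source
equations, and the element equation with `v_λ = A_λᵀ e`.  The total derivatives
`d/dt q(A_Cᵀ e, t)` and `d/dt φ_L(i_L, t)` are expanded by the chain rule. -/
noncomputable def coupledDAE {G : CircuitGraph ν β} (M : CircuitModel G)
    (F : ElementFun δ (G.Br .lam)) :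
    CoupledState G δ → CoupledState G δ → ℝ →
      (ν → ℝ) × (G.Br .L → ℝ) × (G.Br .V → ℝ) × (δ ⊕ G.Br .lam → ℝ) :=
  fun (e', iL', _iV', x', i') (e, iL, iV, x, i) t =>
    (G.A .C *ᵥ fderiv ℝ M.q ((G.A .C)ᵀ *ᵥ e, t) ((G.A .C)ᵀ *ᵥ e', 1)
        + G.A .R *ᵥ M.g ((G.A .R)ᵀ *ᵥ e, t)
        + G.A .L *ᵥ iL + G.A .V *ᵥ iV + G.A .lam *ᵥ i + G.A .I *ᵥ M.isrc t,
      fderiv ℝ M.φL (iL, t) (iL', 1) - (G.A .L)ᵀ *ᵥ e,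
      (G.A .V)ᵀ *ᵥ e - M.vsrc t,
      F (x', i', x, i, (G.A .lam)ᵀ *ᵥ e, t))

/-- The linear map `(e, i_L, i_V, x_λ, i_λ) ↦ (Q e, 0, Q' i_V, 0, 0)`. -/
def componentMap (G : CircuitGraph ν β) (δ : Type*) (Q : Matrix ν ν ℝ)
    (Q' : Matrix (G.Br .V) (G.Br .V) ℝ) : CoupledState G δ →ₗ[ℝ] CoupledState G δ where
  toFun := fun z => (Q *ᵥ z.1, 0, Q' *ᵥ z.2.2.1, 0, 0)
  map_add' := fun y z => by simp [Matrix.mulVec_add]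
  map_smul' := fun c z => by simp [Matrix.mulVec_smul]

end Coupled

/-!
The equations obtained from a DAE `F = 0` by `m` differentiations form a calculus: they may be
added, multiplied by smooth operators `K(x, t)`, and an obtained algebraic equation `h(x, t) = 0`
may be differentiated at the price of one more differentiation (`ObtainedBy.deriv`). The last rule
rests on the chain rule in the form of `totalDeriv_eq_iteratedDeriv`: total derivatives may be
computed along any curve with the given jet.

*What one differentiation determines.* The equations of the coupled system, the differentiated
voltage source equations, the reduced element equations and the differentiated part `QCᵀ` of
Kirchhoff's current law (which contains no derivatives, as `QCᵀ A_C = 0`) are affine in `x'`. By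
positive definiteness the kernel of their leading coefficient is exactly the range of the
projector `T = (QCRV, 0, QVC, 0, 0)` (`leadingCoeff_eq_zero_iff`). A smooth family of operators with
constant kernel has a smooth left inverse modulo this kernel
(`exists_contDiffOn_leftInverse`), so `x' - T x'` is determined after one differentiation.

*What two differentiations determine.* There are two hidden constraints, both obtained after one
differentiation. In the LIλ-cutsets the differentiated current law, with `i_L'` and `i_λ'`
substituted, restricts the potentials `QCRV e` (`cutsetConstraint`); in the CV-loops the
differentiated voltage law, with `A_Cᵀ e'` substituted, restricts the currents `QVC i_V`
(`loopConstraint`). Their `x`-derivative is injective on the range of `T`, because the inductances,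
the `∂/∂v_λ` of the element's current rate and the inverse nodal matrix are positive definite and
there are neither I-cutsets nor V-loops. Differentiating the constraints yields all of `x'`
(`determinedAfter_two`).

*What one differentiation does not determine.* Let `M T x` be the linear term of the index-2
components in the equations. At a consistent jet, replacing `x'` by `x' + T w` changes `dF/dt`
by `M T w`, and this can be compensated by a change of `x''` provided that `M T w` lies in the range
of `∂F/∂x'`. For the rows of the circuit this follows from positive definiteness. For the element it
says that `im B ⊆ im ∂F/∂(x', i')`, which is forced by the element being inductance-like together
with a dimension count (`exists_fderiv_elementDAE_eq`). Hence the functionals determined after one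
differentiation vanish on the range of `T`. That range is not zero, since the potential that is `1`
on a component cut off from the ground by an LIλ-cutset is seen by no branch of kind C, R or V.
-/

/-! ### Derivative arrays -/

section DerivativeArray

variable {X W U V : Type*} [NormedAddCommGroup X] [NormedSpace ℝ X]
  [NormedAddCommGroup W] [NormedSpace ℝ W] [NormedAddCommGroup U] [NormedSpace ℝ U]
  [NormedAddCommGroup V] [NormedSpace ℝ V]

theorem contDiff_jetCurve {n : ℕ} (u : Fin n → X) (t : ℝ) : ContDiff ℝ ∞ (jetCurve u t) := by
  unfold jetCurve
  fun_prop

theorem jetCurve_self {n : ℕ} (u : Fin (n + 1) → X) (t : ℝ) : jetCurve u t t = u 0 := by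
  simp [jetCurve, Fin.sum_univ_succ]

theorem deriv_jetCurve {n : ℕ} (u : Fin (n + 1) → X) (t : ℝ) :
    deriv (jetCurve u t) = jetCurve (Fin.tail u) t := by
  funext s
  refine HasDerivAt.deriv ?_
  have h : ∀ j : Fin n, HasDerivAt
      (fun s => ((s - t) ^ ((j : ℕ) + 1) / (((j : ℕ) + 1).factorial : ℝ)) • u j.succ)
      (((s - t) ^ (j : ℕ) / ((j : ℕ).factorial : ℝ)) • u j.succ) s := by
    intro j
    refine HasDerivAt.smul_const ?_ _
    have h1 := (((hasDerivAt_id s).sub_const t).pow ((j : ℕ) + 1)).div_const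
      (((j : ℕ) + 1).factorial : ℝ)
    refine h1.congr_deriv ?_
    have : ((j : ℕ).factorial : ℝ) ≠ 0 := by positivity
    rw [Nat.factorial_succ]
    push_cast
    simp only [id, mul_one]
    field_simp
  have h2 := (HasDerivAt.fun_sum (u := Finset.univ) fun j _ => h j).const_add (u 0)
  refine (h2.congr_of_eventuallyEq (Filter.Eventually.of_forall fun s => ?_)).congr_deriv ?_
  · simp [jetCurve, Fin.sum_univ_succ]
  · simp [jetCurve, Fin.tail]

theorem iteratedDeriv_jetCurve (k : ℕ) : ∀ {n : ℕ} (u : Fin n → X) (t : ℝ) (hk : k < n),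
    iteratedDeriv k (jetCurve u t) t = u ⟨k, hk⟩ := by
  induction k with
  | zero =>
    intro n u t hk
    obtain ⟨n, rfl⟩ : ∃ m, n = m + 1 := ⟨n - 1, by omega⟩
    simp [jetCurve_self]
  | succ k ih =>
    intro n u t hk
    obtain ⟨n, rfl⟩ : ∃ m, n = m + 1 := ⟨n - 1, by omega⟩
    rw [iteratedDeriv_succ', deriv_jetCurve, ih _ _ (by omega)]
    rfl

theorem iteratedDeriv_prodMk {f : ℝ → X} {g : ℝ → W} {t : ℝ} (hf : ContDiff ℝ ∞ f)
    (hg : ContDiff ℝ ∞ g) (k : ℕ) :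
    iteratedDeriv k (fun s => (f s, g s)) t = (iteratedDeriv k f t, iteratedDeriv k g t) := by
  simp only [iteratedDeriv]
  rw [iteratedFDeriv_prodMk (n := ∞) hf.contDiffAt hg.contDiffAt (by exact_mod_cast le_top)]
  rfl

/-- By the chain rule, the `j`-th derivative of `f ∘ γ` depends only on the jet of order `j`
of `γ`. -/
theorem iteratedDeriv_comp_congr {f : X → W} (hf : ContDiff ℝ ∞ f) {γ₁ γ₂ : ℝ → X}
    (h₁ : ContDiff ℝ ∞ γ₁) (h₂ : ContDiff ℝ ∞ γ₂) {t : ℝ} {j : ℕ}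
    (h : ∀ k ≤ j, iteratedDeriv k γ₁ t = iteratedDeriv k γ₂ t) :
    iteratedDeriv j (f ∘ γ₁) t = iteratedDeriv j (f ∘ γ₂) t := by
  have h0 : γ₁ t = γ₂ t := by simpa using h 0 (Nat.zero_le _)
  have hj : ((j : ℕ) : WithTop ℕ∞) ≤ ∞ := by exact_mod_cast le_top
  rw [iteratedDeriv_vcomp_eq_sum_orderedFinpartition hf.contDiffAt h₁.contDiffAt hj,
    iteratedDeriv_vcomp_eq_sum_orderedFinpartition hf.contDiffAt h₂.contDiffAt hj, h0]
  refine Finset.sum_congr rfl fun c _ => ?_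
  congr 1
  funext i
  exact h _ (c.partSize_le i)

/-- The curve on which the function `F(x', x, t)` is evaluated along `x = c(t)`. -/
noncomputable def liftCurve (c : ℝ → X) (s : ℝ) : X × X × ℝ := (deriv c s, c s, s)

theorem contDiff_deriv_curve {c : ℝ → X} (hc : ContDiff ℝ ∞ c) : ContDiff ℝ ∞ (deriv c) :=
  (contDiff_infty_iff_deriv.1 hc).2

theorem contDiff_iteratedDeriv {c : ℝ → X} (hc : ContDiff ℝ ∞ c) (k : ℕ) :
    ContDiff ℝ ∞ (iteratedDeriv k c) := by
  rw [iteratedDeriv_eq_iterate]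
  exact hc.iterate_deriv k

theorem contDiff_liftCurve {c : ℝ → X} (hc : ContDiff ℝ ∞ c) : ContDiff ℝ ∞ (liftCurve c) :=
  (contDiff_deriv_curve hc).prodMk (hc.prodMk contDiff_id)

/-- The function `F(x', x, t)` of a DAE, with its arguments collected in a triple. -/
def triFun (F : X → X → ℝ → W) (p : X × X × ℝ) : W := F p.1 p.2.1 p.2.2

/-- The expression `d^j/dt^j F(x', x, t)` may be computed along any curve with the given jet. -/
theorem totalDeriv_eq_iteratedDeriv {F : X → X → ℝ → W} (hF : ContDiff ℝ ∞ (triFun F))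
    {n : ℕ} (u : Fin n → X) {c : ℝ → X} (hc : ContDiff ℝ ∞ c) (t : ℝ) {j : ℕ} (hj : j + 1 < n)
    (h : ∀ k (hk : k < n), k ≤ j + 1 → iteratedDeriv k c t = u ⟨k, hk⟩) :
    totalDeriv F j u t = iteratedDeriv j (triFun F ∘ liftCurve c) t := by
  have hJ := contDiff_jetCurve u t
  refine iteratedDeriv_comp_congr (γ₁ := liftCurve (jetCurve u t)) hF (contDiff_liftCurve hJ)
    (contDiff_liftCurve hc) fun k hk => ?_
  unfold liftCurve
  rw [iteratedDeriv_prodMk (contDiff_deriv_curve hJ) (hJ.prodMk contDiff_fun_id),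
    iteratedDeriv_prodMk hJ contDiff_fun_id,
    iteratedDeriv_prodMk (contDiff_deriv_curve hc) (hc.prodMk contDiff_fun_id),
    iteratedDeriv_prodMk hc contDiff_fun_id, ← iteratedDeriv_succ', ← iteratedDeriv_succ',
    h (k + 1) (by omega) (by omega), h k (by omega) (by omega), iteratedDeriv_jetCurve,
    iteratedDeriv_jetCurve]

theorem totalDeriv_zero (F : X → X → ℝ → W) {n : ℕ} (u : Fin (n + 2) → X) (t : ℝ) :
    totalDeriv F 0 u t = F (u 1) (u 0) t := by
  simp only [totalDeriv, iteratedDeriv_zero]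
  rw [deriv_jetCurve, jetCurve_self, jetCurve_self]
  rfl

theorem hasDerivAt_curve {c : ℝ → X} (hc : ContDiff ℝ ∞ c) (s : ℝ) :
    HasDerivAt c (deriv c s) s :=
  ((hc.differentiable (by simp)) s).hasDerivAt

theorem totalDeriv_one {F : X → X → ℝ → W} (hF : ContDiff ℝ ∞ (triFun F))
    {n : ℕ} (u : Fin (n + 3) → X) (t : ℝ) :
    totalDeriv F 1 u t = fderiv ℝ (triFun F) (u 1, u 0, t) (u 2, u 1, 1) := by
  have hJ := contDiff_jetCurve u t
  have h := ((hF.differentiable (by simp)) (liftCurve (jetCurve u t) t)).hasFDerivAt.comp_hasDerivAt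
    t ((hasDerivAt_curve (contDiff_deriv_curve hJ) t).prodMk
      ((hasDerivAt_curve hJ t).prodMk (hasDerivAt_id t)))
  have h1 : totalDeriv F 1 u t = deriv (triFun F ∘ liftCurve (jetCurve u t)) t := by
    simp only [totalDeriv, iteratedDeriv_one]
    rfl
  have h2 := h.deriv
  rw [h1]
  refine h2.trans ?_
  simp only [liftCurve, deriv_jetCurve, jetCurve_self]
  rfl

/-- Truncating the jet does not change those total derivatives for which it is long enough. -/
theorem totalDeriv_init {F : X → X → ℝ → W} (hF : ContDiff ℝ ∞ (triFun F))
    {n : ℕ} (u : Fin (n + 1) → X) (t : ℝ) {j : ℕ} (hj : j + 1 < n) :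
    totalDeriv F j (Fin.init u) t = totalDeriv F j u t := by
  rw [totalDeriv_eq_iteratedDeriv hF (Fin.init u) (contDiff_jetCurve u t) t hj]
  · rfl
  · intro k hk _
    rw [iteratedDeriv_jetCurve _ _ _ (by omega)]
    rfl

/-! ### Algebraic manipulations of derivative arrays -/

variable {I : Set ℝ} {F : X → X → ℝ → W} {m : ℕ}

theorem ObtainedBy.congr {E E' : X → X → ℝ → U} (h : ObtainedBy I F m E)
    (hE : ∀ y x, ∀ t ∈ I, E' y x t = E y x t) : ObtainedBy I F m E' := by
  obtain ⟨R, hR, h⟩ := h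
  exact ⟨R, hR, fun t ht u => (hE _ _ t ht).trans (h t ht u)⟩

theorem ObtainedBy.add {E E' : X → X → ℝ → U} (h : ObtainedBy I F m E)
    (h' : ObtainedBy I F m E') : ObtainedBy I F m (fun y x t => E y x t + E' y x t) := by
  obtain ⟨R, hR, h⟩ := h
  obtain ⟨R', hR', h'⟩ := h'
  refine ⟨fun j p => R j p + R' j p, fun j => (hR j).add (hR' j), fun t ht u => ?_⟩
  simp only [h t ht u, h' t ht u, add_apply, Finset.sum_add_distrib]

theorem ObtainedBy.clm_apply {E : X → X → ℝ → U} (h : ObtainedBy I F m E)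
    {K : X × ℝ → U →L[ℝ] V} (hK : ContDiffOn ℝ ∞ K (Set.univ ×ˢ I)) :
    ObtainedBy I F m (fun y x t => K (x, t) (E y x t)) := by
  obtain ⟨R, hR, h⟩ := h
  refine ⟨fun j p => (K (p.1 0, p.2)).comp (R j p), fun j => ?_, fun t ht u => ?_⟩
  · refine ContDiffOn.clm_comp (hK.comp (ContDiff.contDiffOn ?_) ?_) (hR j)
    · fun_prop
    · rintro ⟨u, t⟩ ⟨_, ht⟩
      exact ⟨trivial, ht⟩
  · simp only [h t ht u, map_sum, ContinuousLinearMap.comp_apply]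

theorem ObtainedBy.clm {E : X → X → ℝ → U} (h : ObtainedBy I F m E) (K : U →L[ℝ] V) :
    ObtainedBy I F m (fun y x t => K (E y x t)) :=
  h.clm_apply (K := fun _ => K) contDiffOn_const

theorem ObtainedBy.sub {E E' : X → X → ℝ → U} (h : ObtainedBy I F m E)
    (h' : ObtainedBy I F m E') : ObtainedBy I F m (fun y x t => E y x t - E' y x t) :=
  (h.add (h'.clm (-ContinuousLinearMap.id ℝ U))).congr fun y x t _ => by simp [sub_eq_add_neg]

theorem ObtainedBy.prodMk {E : X → X → ℝ → U} {E' : X → X → ℝ → V} (h : ObtainedBy I F m E)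
    (h' : ObtainedBy I F m E') : ObtainedBy I F m (fun y x t => (E y x t, E' y x t)) :=
  ((h.clm (ContinuousLinearMap.inl ℝ U V)).add (h'.clm (ContinuousLinearMap.inr ℝ U V))).congr
    fun y x t _ => by simp

theorem obtainedBy_self : ObtainedBy I F 0 F := by
  refine ⟨fun _ _ => ContinuousLinearMap.id ℝ W, fun _ => contDiffOn_const, fun t _ u => ?_⟩
  simp [totalDeriv_zero]

theorem contDiff_init {n : ℕ} : ContDiff ℝ ∞ (fun u : Fin (n + 1) → X => Fin.init u) :=
  contDiff_pi.2 fun i => contDiff_apply ℝ X (Fin.castSucc i)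

theorem contDiff_tail {n : ℕ} : ContDiff ℝ ∞ (fun u : Fin (n + 1) → X => Fin.tail u) :=
  contDiff_pi.2 fun i => contDiff_apply ℝ X (Fin.succ i)

theorem ContDiffOn.comp_init {n : ℕ} {R : (Fin n → X) × ℝ → U}
    (hR : ContDiffOn ℝ ∞ R (Set.univ ×ˢ I)) :
    ContDiffOn ℝ ∞ (fun p : (Fin (n + 1) → X) × ℝ => R (Fin.init p.1, p.2)) (Set.univ ×ˢ I) := by
  refine hR.comp (ContDiff.contDiffOn ?_) fun p hp => ⟨trivial, hp.2⟩
  exact (contDiff_init.comp contDiff_fst).prodMk contDiff_snd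

theorem ObtainedBy.succ (hF : ContDiff ℝ ∞ (triFun F)) {E : X → X → ℝ → U}
    (h : ObtainedBy I F m E) : ObtainedBy I F (m + 1) E := by
  obtain ⟨R, hR, h⟩ := h
  refine ⟨Fin.snoc (α := fun _ => (Fin (m + 1 + 2) → X) × ℝ → (W →L[ℝ] U))
    (fun j p => R j (Fin.init p.1, p.2)) (fun _ => 0), fun j => ?_, fun t ht u => ?_⟩
  · refine Fin.lastCases ?_ (fun j => ?_) j
    · simpa only [Fin.snoc_last] using contDiffOn_const
    · simpa only [Fin.snoc_castSucc] using (hR j).comp_init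
  · rw [Fin.sum_univ_castSucc]
    simp only [Fin.snoc_castSucc, Fin.snoc_last, zero_apply,
      add_zero]
    refine (h t ht (Fin.init u)).trans (Finset.sum_congr rfl fun j _ => ?_)
    rw [totalDeriv_init hF _ _ (by omega)]
    rfl

/-- One more differentiation turns an algebraic equation `h(x, t) = 0` into
`∂h/∂x x' + ∂h/∂t = 0`.  At a boundary point of `I` the derivatives are one-sided, since the
coefficients of an obtained equation are given only for times in `I`. -/
theorem ObtainedBy.deriv (hI : UniqueDiffOn ℝ I) (hF : ContDiff ℝ ∞ (triFun F))
    {h : X × ℝ → U} (hh : ObtainedBy I F m (fun _ x t => h (x, t)))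
    {D : X × ℝ → X × ℝ →L[ℝ] U}
    (hD : ∀ x, ∀ t ∈ I, HasFDerivWithinAt h (D (x, t)) (Set.univ ×ˢ I) (x, t)) :
    ObtainedBy I F (m + 1) (fun y x t => D (x, t) (y, 1)) := by
  obtain ⟨R, hR, hh⟩ := hh
  have hU : UniqueDiffOn ℝ ((Set.univ : Set (Fin (m + 2) → X)) ×ˢ I) := uniqueDiffOn_univ.prod hI
  let R' : Fin (m + 1) → (Fin (m + 1 + 2) → X) × ℝ → (W →L[ℝ] U) := fun j p =>
    fderivWithin ℝ (R j) (Set.univ ×ˢ I) (Fin.init p.1, p.2) (Fin.tail p.1, 1)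
  have hR' : ∀ j, ContDiffOn ℝ ∞ (R' j) (Set.univ ×ˢ I) := by
    intro j
    refine ContDiffOn.clm_apply (((hR j).fderivWithin hU (m := ∞) (by simp)).comp_init) ?_
    exact ((contDiff_tail.comp contDiff_fst).prodMk contDiff_const).contDiffOn
  -- the identity for `h` holds along the curve `jetCurve u t` at all times in `I`; both sides are
  -- differentiated at `t` within `I`
  have key : ∀ t ∈ I, ∀ u : Fin (m + 1 + 2) → X, D (u 0, t) (u 1, 1) =
      ∑ j : Fin (m + 1), (R' j (u, t) (totalDeriv F j u t) +
        R j (Fin.init u, t) (totalDeriv F (j + 1) u t)) := by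
    intro t ht u
    have hc := contDiff_jetCurve u t
    set c := jetCurve u t with hcdef
    let J : ℝ → Fin (m + 2) → X := fun s i => iteratedDeriv i c s
    have hJt : J t = Fin.init u := by
      funext i
      exact iteratedDeriv_jetCurve _ _ _ (by omega)
    have hcs : ∀ k : ℕ, ContDiff ℝ ∞ (iteratedDeriv k c) := fun k =>
      contDiff_iteratedDeriv hc k
    have hJ : HasDerivAt J (Fin.tail u) t := by
      refine hasDerivAt_pi.2 fun i => ?_
      have := hasDerivAt_curve (hcs i) t
      rw [← iteratedDeriv_succ, iteratedDeriv_jetCurve _ _ _ (by omega)] at this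
      exact this
    have hG : ContDiff ℝ ∞ (triFun F ∘ liftCurve c) := hF.comp (contDiff_liftCurve hc)
    have e1 : ∀ s ∈ I, h (c s, s) = ∑ j : Fin (m + 1),
        R j (J s, s) (iteratedDeriv j (triFun F ∘ liftCurve c) s) := by
      intro s hs
      have : h (J s 0, s) = _ := hh s hs (J s)
      have e0 : J s 0 = c s := by simp [J]
      rw [e0] at this
      rw [this]
      refine Finset.sum_congr rfl fun j _ => ?_
      rw [totalDeriv_eq_iteratedDeriv hF (J s) hc s (by omega) fun k hk _ => rfl]
    have c0 : c t = u 0 := jetCurve_self _ _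
    have c1 : _root_.deriv c t = u 1 := by
      rw [hcdef, deriv_jetCurve, jetCurve_self]
      rfl
    have d1 : HasDerivWithinAt (fun s => h (c s, s)) (D (u 0, t) (u 1, 1)) I t := by
      have hcur : HasDerivWithinAt (fun s => (c s, s)) (u 1, (1 : ℝ)) I t := by
        rw [← c1]
        exact ((hasDerivAt_curve hc t).prodMk (hasDerivAt_id t)).hasDerivWithinAt
      have := hD (u 0) t ht
      rw [← c0] at this ⊢
      exact this.comp_hasDerivWithinAt (f := fun s => (c s, s)) t hcur fun s hs => ⟨trivial, hs⟩
    have d2 : HasDerivWithinAt (fun s => ∑ j : Fin (m + 1),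
        R j (J s, s) (iteratedDeriv j (triFun F ∘ liftCurve c) s))
        (∑ j : Fin (m + 1), (R' j (u, t) (totalDeriv F j u t) +
          R j (Fin.init u, t) (totalDeriv F (j + 1) u t))) I t := by
      refine HasDerivWithinAt.fun_sum fun j _ => ?_
      have a1 : HasDerivWithinAt (fun s => R j (J s, s)) (R' j (u, t)) I t := by
        have b1 : HasFDerivWithinAt (R j)
            (fderivWithin ℝ (R j) (Set.univ ×ˢ I) (Fin.init u, t)) (Set.univ ×ˢ I) (J t, t) := by
          rw [hJt]
          exact (((hR j).differentiableOn (by simp)) _ ⟨trivial, ht⟩).hasFDerivWithinAt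
        exact b1.comp_hasDerivWithinAt (f := fun s => (J s, s)) t (hJ.prodMk (hasDerivAt_id t)).hasDerivWithinAt
          fun s hs => ⟨trivial, hs⟩
      have a2 : HasDerivWithinAt (fun s => iteratedDeriv j (triFun F ∘ liftCurve c) s)
          (totalDeriv F (j + 1) u t) I t := by
        have : totalDeriv F (j + 1) u t
            = _root_.deriv (iteratedDeriv j (triFun F ∘ liftCurve c)) t :=
          congrFun iteratedDeriv_succ t
        rw [this]
        exact (hasDerivAt_curve (contDiff_iteratedDeriv hG j) t).hasDerivWithinAt
      have a3 := a1.clm_apply a2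
      rw [hJt] at a3
      exact a3
    exact (hI t ht).eq_deriv _ (d1.congr (fun s hs => (e1 s hs).symm) (e1 t ht).symm) d2
  refine ⟨fun j p => (Fin.snoc (α := fun _ => (Fin (m + 1 + 2) → X) × ℝ → (W →L[ℝ] U)) R' fun _ => 0) j p
      + (Fin.cons (α := fun _ => (Fin (m + 1 + 2) → X) × ℝ → (W →L[ℝ] U)) (fun _ => 0)
        (fun j p => R j (Fin.init p.1, p.2))) j p, fun j => ?_, fun t ht u => ?_⟩
  · refine ContDiffOn.add ?_ ?_
    · refine Fin.lastCases ?_ (fun j => ?_) j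
      · simpa only [Fin.snoc_last] using contDiffOn_const
      · simpa only [Fin.snoc_castSucc] using hR' j
    · refine Fin.cases ?_ (fun j => ?_) j
      · simpa only [Fin.cons_zero] using contDiffOn_const
      · simpa only [Fin.cons_succ] using (hR j).comp_init
  · simp only [add_apply, Finset.sum_add_distrib]
    rw [Fin.sum_univ_castSucc, Fin.sum_univ_succ (n := m + 1)]
    simp only [Fin.snoc_castSucc, Fin.snoc_last, Fin.cons_zero, Fin.cons_succ,
      zero_apply, add_zero, zero_add]
    rw [key t ht u, Finset.sum_add_distrib]
    rfl

theorem jetCurve_map {X' : Type*} [NormedAddCommGroup X'] [NormedSpace ℝ X'] (P : X →L[ℝ] X')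
    {n : ℕ} (u : Fin n → X) (t : ℝ) :
    jetCurve (fun i => P (u i)) t = fun s => P (jetCurve u t s) := by
  funext s
  simp [jetCurve, map_sum]

theorem totalDeriv_map {X' W' : Type*} [NormedAddCommGroup X'] [NormedSpace ℝ X']
    [NormedAddCommGroup W'] [NormedSpace ℝ W'] {F' : X' → X' → ℝ → W'}
    (hF : ContDiff ℝ ∞ (triFun F)) (P : X →L[ℝ] X') (π : W →L[ℝ] W')
    (hπ : ∀ y x t, π (F y x t) = F' (P y) (P x) t) (j : ℕ) {n : ℕ} (u : Fin n → X) (t : ℝ) :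
    totalDeriv F' j (fun i => P (u i)) t = π (totalDeriv F j u t) := by
  have hJ := contDiff_jetCurve u t
  have e : (fun s => F' (deriv (jetCurve (fun i => P (u i)) t) s)
      (jetCurve (fun i => P (u i)) t s) s) = π ∘ (triFun F ∘ liftCurve (jetCurve u t)) := by
    funext s
    have hd := (P.hasFDerivAt.comp_hasDerivAt s (hasDerivAt_curve hJ s)).deriv
    simp only [jetCurve_map, Function.comp_apply, triFun, liftCurve, hπ]
    congr 1
  have hG : ContDiff ℝ ∞ (triFun F ∘ liftCurve (jetCurve u t)) := hF.comp (contDiff_liftCurve hJ)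
  unfold totalDeriv
  rw [e, iteratedDeriv, π.iteratedFDeriv_comp_left (n := ∞) hG.contDiffAt
    (by exact_mod_cast le_top)]
  rfl

/-- An equation obtained from a DAE is obtained from every system of which that DAE is a part. -/
theorem ObtainedBy.transfer {X' W' : Type*} [NormedAddCommGroup X'] [NormedSpace ℝ X']
    [NormedAddCommGroup W'] [NormedSpace ℝ W'] {F' : X' → X' → ℝ → W'}
    (hF : ContDiff ℝ ∞ (triFun F)) (P : X →L[ℝ] X') (π : W →L[ℝ] W')
    (hπ : ∀ y x t, π (F y x t) = F' (P y) (P x) t) {E : X' → X' → ℝ → U}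
    (h : ObtainedBy I F' m E) : ObtainedBy I F m (fun y x t => E (P y) (P x) t) := by
  obtain ⟨R, hR, h⟩ := h
  refine ⟨fun j p => (R j (fun i => P (p.1 i), p.2)).comp π, fun j => ?_, fun t ht u => ?_⟩
  · refine ContDiffOn.clm_comp ((hR j).comp (ContDiff.contDiffOn ?_) fun p hp => ⟨trivial, hp.2⟩)
      contDiffOn_const
    fun_prop
  · refine (h t ht fun i => P (u i)).trans (Finset.sum_congr rfl fun j _ => ?_)
    rw [totalDeriv_map hF P π hπ]
    rfl

end DerivativeArray

/-! ### Smooth families of linear maps -/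

section LinearFamilies

theorem ContinuousLinearMap.isInvertible_of_ker_eq_bot {E : Type*} [NormedAddCommGroup E]
    [NormedSpace ℝ E] [FiniteDimensional ℝ E] (A : E →L[ℝ] E) (hA : ∀ w, A w = 0 → w = 0) :
    A.IsInvertible := by
  have hinj : Function.Injective (A : E →ₗ[ℝ] E) :=
    (injective_iff_map_eq_zero _).2 fun w hw => hA w hw
  refine ⟨(LinearEquiv.ofInjectiveEndo _ hinj).toContinuousLinearEquiv, ?_⟩
  ext w
  simp

variable {P : Type*} [NormedAddCommGroup P] [NormedSpace ℝ P] {s : Set P}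

theorem ContDiffOn.clm_inverse {E : Type*} [NormedAddCommGroup E] [NormedSpace ℝ E]
    [CompleteSpace E] {A : P → E →L[ℝ] E} (hA : ContDiffOn ℝ ∞ A s)
    (h : ∀ p ∈ s, (A p).IsInvertible) : ContDiffOn ℝ ∞ (fun p => (A p).inverse) s := fun p hp =>
  (h p hp).contDiffAt_map_inverse.comp_contDiffWithinAt p (hA p hp)

/-- Passing to the adjoint, as a continuous linear map of operator spaces. -/
noncomputable def adjointCLM (E G : Type*) [NormedAddCommGroup E] [InnerProductSpace ℝ E]
    [FiniteDimensional ℝ E] [CompleteSpace E] [NormedAddCommGroup G] [InnerProductSpace ℝ G]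
    [FiniteDimensional ℝ G] [CompleteSpace G] : (E →L[ℝ] G) →L[ℝ] (G →L[ℝ] E) :=
  LinearMap.toContinuousLinearMap
    { toFun := fun A => ContinuousLinearMap.adjoint A
      map_add' := fun A B => map_add _ A B
      map_smul' := fun c A => by simp }

/-- A left inverse of `S(p)` modulo its kernel, depending smoothly on `p`, in Euclidean spaces:
`(S* S + T* T)⁻¹ S*`, where `T` is the projector onto the common kernel. -/
theorem exists_contDiffOn_leftInverse_aux {E G : Type*} [NormedAddCommGroup E]
    [InnerProductSpace ℝ E] [FiniteDimensional ℝ E] [CompleteSpace E] [NormedAddCommGroup G]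
    [InnerProductSpace ℝ G] [FiniteDimensional ℝ G] [CompleteSpace G] {S : P → E →L[ℝ] G}
    (hS : ContDiffOn ℝ ∞ S s) (T : E →L[ℝ] E) (hT : ∀ w, T (T w) = T w)
    (hker : ∀ p ∈ s, ∀ w, S p w = 0 ↔ T w = w) :
    ∃ K : P → G →L[ℝ] E, ContDiffOn ℝ ∞ K s ∧ ∀ p ∈ s, ∀ w, K p (S p w) = w - T w := by
  let H : P → E →L[ℝ] E := fun p =>
    (adjointCLM E G (S p)).comp (S p) + (adjointCLM E E T).comp T
  have hadj : ContDiffOn ℝ ∞ (fun p => adjointCLM E G (S p)) s :=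
    (adjointCLM E G).contDiff.comp_contDiffOn hS
  have hH : ContDiffOn ℝ ∞ H s := (hadj.clm_comp hS).add contDiffOn_const
  have hinv : ∀ p ∈ s, (H p).IsInvertible := by
    intro p hp
    refine ContinuousLinearMap.isInvertible_of_ker_eq_bot _ fun w hw => ?_
    have h1 : inner ℝ (S p w) (S p w) + inner ℝ (T w) (T w) = 0 := by
      have h2 : inner ℝ (H p w) w = (0 : ℝ) := by rw [hw, inner_zero_left]
      have h3 : H p w = ContinuousLinearMap.adjoint (S p) (S p w)
        + ContinuousLinearMap.adjoint T (T w) := rfl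
      rw [h3, inner_add_left, ContinuousLinearMap.adjoint_inner_left,
        ContinuousLinearMap.adjoint_inner_left] at h2
      exact h2
    have h2 := real_inner_self_nonneg (x := S p w)
    have h3 := real_inner_self_nonneg (x := T w)
    have h4 : S p w = 0 := inner_self_eq_zero (𝕜 := ℝ).1 (by linarith)
    have h5 : T w = 0 := inner_self_eq_zero (𝕜 := ℝ).1 (by linarith)
    rw [← (hker p hp w).1 h4, h5]
  refine ⟨fun p => (H p).inverse.comp (adjointCLM E G (S p)),
    (hH.clm_inverse hinv).clm_comp hadj, fun p hp w => ?_⟩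
  change (H p).inverse (adjointCLM E G (S p) (S p w)) = _
  have h1 : adjointCLM E G (S p) (S p w) = H p (w - T w) := by
    have h2 : S p (T w) = 0 := (hker p hp _).2 (hT w)
    simp [H, h2, hT]
  rw [h1, (hinv p hp).inverse_apply_self]

/-- A smooth family of linear maps with the constant kernel `im T`, `T` a projector, has a smooth
family of left inverses modulo `im T`. -/
theorem exists_contDiffOn_leftInverse {E G : Type*} [NormedAddCommGroup E] [NormedSpace ℝ E]
    [FiniteDimensional ℝ E] [NormedAddCommGroup G] [NormedSpace ℝ G] [FiniteDimensional ℝ G]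
    {S : P → E →L[ℝ] G} (hS : ContDiffOn ℝ ∞ S s) (T : E →ₗ[ℝ] E) (hT : ∀ w, T (T w) = T w)
    (hker : ∀ p ∈ s, ∀ w, S p w = 0 ↔ T w = w) :
    ∃ K : P → G →L[ℝ] E, ContDiffOn ℝ ∞ K s ∧ ∀ p ∈ s, ∀ w, K p (S p w) = w - T w := by
  let a := toEuclidean (E := E)
  let b := toEuclidean (E := G)
  let a' : E →L[ℝ] EuclideanSpace ℝ (Fin (Module.finrank ℝ E)) := a
  let a'' : EuclideanSpace ℝ (Fin (Module.finrank ℝ E)) →L[ℝ] E := a.symm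
  let b' : G →L[ℝ] EuclideanSpace ℝ (Fin (Module.finrank ℝ G)) := b
  let T' : E →L[ℝ] E := LinearMap.toContinuousLinearMap T
  obtain ⟨K, hK, h⟩ := exists_contDiffOn_leftInverse_aux (s := s)
    (S := fun p => b'.comp ((S p).comp a''))
    (contDiffOn_const.clm_comp (hS.clm_comp contDiffOn_const))
    (a'.comp (T'.comp a''))
    (fun w => by simp [a', a'', T', hT])
    (fun p hp w => by
      have := hker p hp (a.symm w)
      change b (S p (a.symm w)) = 0 ↔ a (T (a.symm w)) = w
      rw [map_eq_zero_iff b b.injective, this, ← a.symm.injective.eq_iff,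
        ContinuousLinearEquiv.symm_apply_apply])
  refine ⟨fun p => a''.comp ((K p).comp b'),
    contDiffOn_const.clm_comp (hK.clm_comp contDiffOn_const), fun p hp w => ?_⟩
  have h1 : K p (b (S p (a.symm (a w)))) = a w - a (T (a.symm (a w))) := h p hp (a w)
  rw [a.symm_apply_apply] at h1
  change a.symm (K p (b (S p w))) = _
  rw [h1, map_sub, a.symm_apply_apply, a.symm_apply_apply]

/-- If `r f = 0` and `e = r₀ f + r g` is injective on a space of the dimension of the
target of `f`, then the inclusion `im f ⊆ ker r` is an equality: `g` maps `ker f` to a complement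
of `ker r`. -/
theorem ker_le_range_of_injective {Y W U : Type*} [AddCommGroup Y] [Module ℝ Y]
    [FiniteDimensional ℝ Y] [AddCommGroup W] [Module ℝ W] [FiniteDimensional ℝ W]
    [AddCommGroup U] [Module ℝ U] [FiniteDimensional ℝ U]
    (hdim : Module.finrank ℝ Y = Module.finrank ℝ W) {f g : Y →ₗ[ℝ] W} {r₀ r : W →ₗ[ℝ] U}
    (hrf : ∀ y, r (f y) = 0) (hinj : ∀ y, r₀ (f y) + r (g y) = 0 → y = 0) :
    LinearMap.ker r ≤ LinearMap.range f := by
  have hle : LinearMap.range f ≤ LinearMap.ker r := by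
    rintro _ ⟨y, rfl⟩
    exact hrf y
  have h1 : Module.finrank ℝ (LinearMap.ker f) ≤ Module.finrank ℝ (LinearMap.range r) := by
    refine LinearMap.finrank_le_finrank_of_injective
      (f := ((r.rangeRestrict ∘ₗ g) ∘ₗ (LinearMap.ker f).subtype)) ?_
    refine (injective_iff_map_eq_zero _).2 fun y hy => ?_
    have hy1 : r (g y) = 0 := congrArg Subtype.val hy
    have hy2 : f y = 0 := y.2
    exact Subtype.ext (hinj y (by rw [hy1, hy2, map_zero, add_zero]))
  have h2 := LinearMap.finrank_range_add_finrank_ker f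
  have h3 := LinearMap.finrank_range_add_finrank_ker r
  exact (Submodule.eq_of_le_of_finrank_le hle (by omega)).ge

end LinearFamilies

/-! ### Positive definite operators -/

section PosDef

variable {ι κ ν : Type*} [Fintype ι] [Fintype ν]

/-- Multiplication by a matrix, as a continuous linear map. -/
noncomputable def mulVecCLM (A : Matrix κ ι ℝ) : (ι → ℝ) →L[ℝ] (κ → ℝ) :=
  LinearMap.toContinuousLinearMap A.mulVecLin

@[simp] theorem mulVecCLM_apply (A : Matrix κ ι ℝ) (w : ι → ℝ) : mulVecCLM A w = A *ᵥ w := rfl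

theorem dotProduct_mulVec_eq [Fintype κ] (A : Matrix κ ι ℝ) (v : κ → ℝ) (w : ι → ℝ) :
    v ⬝ᵥ A *ᵥ w = (Aᵀ *ᵥ v) ⬝ᵥ w := by
  rw [Matrix.dotProduct_mulVec, Matrix.mulVec_transpose]

theorem IsPosDefOp.nonneg {A : (ι → ℝ) →L[ℝ] (ι → ℝ)} (hA : IsPosDefOp A) (w : ι → ℝ) :
    0 ≤ w ⬝ᵥ A w := by
  by_cases hw : w = 0
  · simp [hw]
  · exact (hA w hw).le

theorem IsPosDefOp.eq_zero {A : (ι → ℝ) →L[ℝ] (ι → ℝ)} (hA : IsPosDefOp A) {w : ι → ℝ}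
    (h : w ⬝ᵥ A w ≤ 0) : w = 0 := by
  by_contra hw
  exact absurd (hA w hw) (not_lt.2 h)

theorem IsPosDefOp.isInvertible {A : (ι → ℝ) →L[ℝ] (ι → ℝ)} (hA : IsPosDefOp A) :
    A.IsInvertible :=
  A.isInvertible_of_ker_eq_bot fun w hw => hA.eq_zero (by simp [hw])

theorem IsPosDefOp.inverse {A : (ι → ℝ) →L[ℝ] (ι → ℝ)} (hA : IsPosDefOp A) :
    IsPosDefOp A.inverse := by
  intro w hw
  have h1 : A (A.inverse w) = w := hA.isInvertible.self_apply_inverse w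
  have h2 : A.inverse w ≠ 0 := by
    intro h
    rw [h, map_zero] at h1
    exact hw h1.symm
  have h3 := hA _ h2
  rwa [h1, dotProduct_comm] at h3

/-- `A C Aᵀ + Qᵀ Q`: for `Q` a projector onto `ker Aᵀ`, the regularised nodal matrix of the
branches with incidence matrix `A`. -/
noncomputable def nodalOp (A : Matrix ν ι ℝ) (Q : Matrix ν ν ℝ) (C : (ι → ℝ) →L[ℝ] (ι → ℝ)) :
    (ν → ℝ) →L[ℝ] (ν → ℝ) :=
  (mulVecCLM A).comp (C.comp (mulVecCLM Aᵀ)) + mulVecCLM (Qᵀ * Q)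

theorem nodalOp_apply (A : Matrix ν ι ℝ) (Q : Matrix ν ν ℝ) (C : (ι → ℝ) →L[ℝ] (ι → ℝ))
    (w : ν → ℝ) : nodalOp A Q C w = A *ᵥ C (Aᵀ *ᵥ w) + Qᵀ *ᵥ (Q *ᵥ w) := by
  simp [nodalOp]

theorem isPosDefOp_nodalOp {A : Matrix ν ι ℝ} {Q : Matrix ν ν ℝ}
    {C : (ι → ℝ) →L[ℝ] (ι → ℝ)} (hC : IsPosDefOp C) (hQ : ∀ w, Aᵀ *ᵥ w = 0 → Q *ᵥ w = w) :
    IsPosDefOp (nodalOp A Q C) := by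
  intro w hw
  rw [nodalOp_apply, dotProduct_add, dotProduct_mulVec_eq, dotProduct_mulVec_eq,
    Matrix.transpose_transpose]
  by_cases h : Aᵀ *ᵥ w = 0
  · rw [hQ w h, h, zero_dotProduct, zero_add]
    exact lt_of_le_of_ne (Finset.sum_nonneg fun i _ => mul_self_nonneg _)
      fun h0 => hw (dotProduct_self_eq_zero.1 h0.symm)
  · have h1 := hC _ h
    have h2 : 0 ≤ (Q *ᵥ w) ⬝ᵥ (Q *ᵥ w) := Finset.sum_nonneg fun i _ => mul_self_nonneg _
    linarith

/-- The regularisation by `Qᵀ Q` does not affect the solution: `(A C Aᵀ + Qᵀ Q)⁻¹ A C Aᵀ = 1 - Q`. -/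
theorem nodalOp_inverse_apply {A : Matrix ν ι ℝ} {Q : Matrix ν ν ℝ}
    {C : (ι → ℝ) →L[ℝ] (ι → ℝ)} (hC : IsPosDefOp C) (hQ : ∀ w, Aᵀ *ᵥ w = 0 → Q *ᵥ w = w)
    (hQ' : ∀ w, Aᵀ *ᵥ (Q *ᵥ w) = 0) (w : ν → ℝ) :
    (nodalOp A Q C).inverse (A *ᵥ C (Aᵀ *ᵥ w)) = w - Q *ᵥ w := by
  have h1 : A *ᵥ C (Aᵀ *ᵥ w) = nodalOp A Q C (w - Q *ᵥ w) := by
    rw [nodalOp_apply, Matrix.mulVec_sub, hQ', sub_zero, Matrix.mulVec_sub,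
      hQ (Q *ᵥ w) (hQ' w), sub_self, Matrix.mulVec_zero, add_zero]
  rw [h1, (isPosDefOp_nodalOp hC hQ).isInvertible.inverse_apply_self]

/-- `(ker Aᵀ)^⊥ ⊆ im (A C Aᵀ)` for positive definite `C`. -/
theorem exists_nodal_preimage {A : Matrix ν ι ℝ} {Q : Matrix ν ν ℝ}
    {C : (ι → ℝ) →L[ℝ] (ι → ℝ)} (hC : IsPosDefOp C) (hQ : ∀ w, Aᵀ *ᵥ w = 0 → Q *ᵥ w = w)
    (hQ' : ∀ w, Aᵀ *ᵥ (Q *ᵥ w) = 0) {z : ν → ℝ} (hz : Qᵀ *ᵥ z = 0) :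
    ∃ b, A *ᵥ C (Aᵀ *ᵥ b) = z := by
  have hinv := (isPosDefOp_nodalOp hC hQ).isInvertible
  set b := (nodalOp A Q C).inverse z
  have h1 : A *ᵥ C (Aᵀ *ᵥ b) + Qᵀ *ᵥ (Q *ᵥ b) = z := by
    rw [← nodalOp_apply]
    exact hinv.self_apply_inverse z
  -- pair the equation for `b` with `Q b`, which is orthogonal to `im A` and to `z`
  have h2 : (Q *ᵥ b) ⬝ᵥ (Q *ᵥ b) = 0 := by
    have h3 : (Q *ᵥ b) ⬝ᵥ (A *ᵥ C (Aᵀ *ᵥ b) + Qᵀ *ᵥ (Q *ᵥ b)) = 0 := by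
      rw [h1, ← hQ _ (hQ' b), ← Matrix.transpose_transpose Q, ← dotProduct_mulVec_eq, hz,
        dotProduct_zero]
    rwa [dotProduct_add, dotProduct_mulVec_eq, hQ', zero_dotProduct, zero_add,
      dotProduct_mulVec_eq, Matrix.transpose_transpose, hQ _ (hQ' b)] at h3
  refine ⟨b, ?_⟩
  rwa [dotProduct_self_eq_zero.1 h2, Matrix.mulVec_zero, add_zero] at h1

end PosDef

/-! ### Partial derivatives -/

section Partial

variable {X Y Z W : Type*} [NormedAddCommGroup X] [NormedSpace ℝ X]
  [NormedAddCommGroup Y] [NormedSpace ℝ Y] [NormedAddCommGroup Z] [NormedSpace ℝ Z]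
  [NormedAddCommGroup W] [NormedSpace ℝ W]

theorem fderiv_partial_fst {f : X × Y → W} (hf : ContDiff ℝ ∞ f) (x : X) (y : Y) :
    fderiv ℝ (fun x' => f (x', y)) x = (fderiv ℝ f (x, y)).comp (ContinuousLinearMap.inl ℝ X Y) :=
  (((hf.differentiable (by simp)) (x, y)).hasFDerivAt.comp x
    (hasFDerivAt_prodMk_left x y)).fderiv

theorem fderiv_partial_snd {f : X × Y → W} (hf : ContDiff ℝ ∞ f) (x : X) (y : Y) :
    fderiv ℝ (fun y' => f (x, y')) y = (fderiv ℝ f (x, y)).comp (ContinuousLinearMap.inr ℝ X Y) :=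
  (((hf.differentiable (by simp)) (x, y)).hasFDerivAt.comp y
    (hasFDerivAt_prodMk_right x y)).fderiv

theorem fderiv_apply_split (L : X × ℝ →L[ℝ] W) (y : X) (τ : ℝ) :
    L (y, τ) = L (y, 0) + L (0, τ) := by
  rw [← map_add]
  simp

theorem contDiff_fderiv {f : X → W} (hf : ContDiff ℝ ∞ f) : ContDiff ℝ ∞ (fderiv ℝ f) :=
  hf.fderiv_right (m := ∞) (by simp)

end Partial

/-! ### Circuit topology -/

namespace CircuitGraph

variable {ν β : Type*} (G : CircuitGraph ν β)

theorem reachable_tail_head {S : Set β} {b : β} (hb : b ∈ S) :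
    (G.graphOf S).Reachable (G.tail b) (G.head b) := by
  by_cases h : G.tail b = G.head b
  · rw [h]
  · refine SimpleGraph.Adj.reachable ?_
    rw [graphOf, SimpleGraph.fromRel_adj]
    exact ⟨h, Or.inl ⟨b, hb, rfl, rfl⟩⟩

variable [DecidableEq ν] [Fintype ν]

theorem mem_nodeKer {K : Set BranchKind} {w : ν → ℝ} :
    w ∈ G.nodeKer K ↔ ∀ k ∈ K, (G.A k)ᵀ *ᵥ w = 0 := by
  simp only [nodeKer, Submodule.mem_iInf, LinearMap.mem_ker, Matrix.mulVecLin_apply]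

/-- The voltage of a branch is the difference of the potentials at its ends; the ground node has
potential `0`. -/
theorem transpose_A_mulVec (k : BranchKind) (w : ν → ℝ) (b : G.Br k) :
    ((G.A k)ᵀ *ᵥ w) b = (G.tail b.1).elim 0 w - (G.head b.1).elim 0 w := by
  have h : ∀ o : Option ν, ∑ n, (if o = some n then (1 : ℝ) else 0) * w n = o.elim 0 w := by
    intro o
    cases o <;> simp
  simp only [Matrix.mulVec, dotProduct, Matrix.transpose_apply, A, sub_mul,
    Finset.sum_sub_distrib, h]

/-- Deleting an LIλ-cutset leaves a component without the ground node. Its indicator function is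
a potential that no branch of kind C, R or V sees. -/
theorem nodeKer_ne_bot_of_liesInLILamCutset (h : G.LiesInLILamCutset) :
    G.nodeKer {.C, .R, .V} ≠ ⊥ := by
  classical
  obtain ⟨E, ⟨hE, -⟩, hkind, -⟩ := h
  obtain ⟨n, hn⟩ : ∃ n : ν, ¬ (G.graphOf Eᶜ).Reachable none (some n) := by
    by_contra! hall
    have hall' : ∀ o, (G.graphOf Eᶜ).Reachable none o := by
      rintro (_ | n)
      · exact SimpleGraph.Reachable.refl _
      · exact hall n
    exact hE ⟨fun a b => (hall' a).symm.trans (hall' b)⟩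
  let w : ν → ℝ := fun n => if (G.graphOf Eᶜ).Reachable none (some n) then 0 else 1
  have hw : ∀ o : Option ν,
      o.elim 0 w = if (G.graphOf Eᶜ).Reachable none o then 0 else 1 := by
    rintro (_ | n)
    · simp
    · rfl
  intro hbot
  have hmem : w ∈ G.nodeKer {.C, .R, .V} := by
    refine G.mem_nodeKer.2 fun k hk => ?_
    funext b
    rw [transpose_A_mulVec, hw, hw]
    have hb : b.1 ∈ Eᶜ := by
      intro hbE
      have := hkind _ hbE
      rw [b.2] at this
      rcases hk with rfl | rfl | rfl <;> simp at this
    have hr := G.reachable_tail_head hb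
    have : (G.graphOf Eᶜ).Reachable none (G.tail b.1) ↔
        (G.graphOf Eᶜ).Reachable none (G.head b.1) :=
      ⟨fun h => h.trans hr, fun h => h.trans hr.symm⟩
    simp [this]
  rw [hbot, Submodule.mem_bot] at hmem
  have := congrFun hmem n
  simp [w, hn] at this

end CircuitGraph

/-! ### The projectors -/

theorem transpose_mulVec_eq_zero {ν ι : Type*} [Fintype ν] [Fintype ι] {A : Matrix ν ι ℝ} {Q : Matrix ν ν ℝ}
    (h : ∀ w, Aᵀ *ᵥ (Q *ᵥ w) = 0) (z : ι → ℝ) : Qᵀ *ᵥ (A *ᵥ z) = 0 := by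
  rw [← dotProduct_self_eq_zero]
  rw [dotProduct_mulVec_eq, Matrix.transpose_transpose, dotProduct_mulVec_eq, h, zero_dotProduct]

section Projectors

theorem componentMap_apply {ν β δ : Type*} [Fintype ν] [Fintype β] {G : CircuitGraph ν β}
    {QCRV : Matrix ν ν ℝ} {QVC : Matrix (G.Br .V) (G.Br .V) ℝ} (z : CoupledState G δ) :
    componentMap G δ QCRV QVC z = (QCRV *ᵥ z.1, 0, QVC *ᵥ z.2.2.1, 0, 0) := rfl

variable {ν β : Type*} [Fintype ν] [DecidableEq ν] [Fintype β] (G : CircuitGraph ν β)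

/-- `QC`, `QCRV`, `QVC` are projectors onto `ker A_Cᵀ`, `ker (A_C A_R A_V)ᵀ` and `ker QCᵀ A_V`,
written out in terms of vectors. -/
structure CircuitProjectors (QC QCRV : Matrix ν ν ℝ) (QVC : Matrix (G.Br .V) (G.Br .V) ℝ) :
    Prop where
  C_mem : ∀ w, (G.A .C)ᵀ *ᵥ (QC *ᵥ w) = 0
  C_id : ∀ w, (G.A .C)ᵀ *ᵥ w = 0 → QC *ᵥ w = w
  CRV_mem_C : ∀ w, (G.A .C)ᵀ *ᵥ (QCRV *ᵥ w) = 0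
  CRV_mem_R : ∀ w, (G.A .R)ᵀ *ᵥ (QCRV *ᵥ w) = 0
  CRV_mem_V : ∀ w, (G.A .V)ᵀ *ᵥ (QCRV *ᵥ w) = 0
  CRV_id : ∀ w, (G.A .C)ᵀ *ᵥ w = 0 → (G.A .R)ᵀ *ᵥ w = 0 → (G.A .V)ᵀ *ᵥ w = 0 → QCRV *ᵥ w = w
  V_mem : ∀ j, QCᵀ *ᵥ (G.A .V *ᵥ (QVC *ᵥ j)) = 0
  V_id : ∀ j, QCᵀ *ᵥ (G.A .V *ᵥ j) = 0 → QVC *ᵥ j = j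

variable {G} {QC QCRV : Matrix ν ν ℝ} {QVC : Matrix (G.Br .V) (G.Br .V) ℝ}

theorem CircuitProjectors.of_isProj
    (hQC : LinearMap.IsProj (G.nodeKer {.C}) QC.mulVecLin)
    (hQCRV : LinearMap.IsProj (G.nodeKer {.C, .R, .V}) QCRV.mulVecLin)
    (hQVC : LinearMap.IsProj (LinearMap.ker (QCᵀ * G.A .V).mulVecLin) QVC.mulVecLin) :
    CircuitProjectors G QC QCRV QVC where
  C_mem w := G.mem_nodeKer.1 (hQC.map_mem w) _ rfl
  C_id w hw := hQC.map_id w (G.mem_nodeKer.2 fun k hk => by rwa [Set.mem_singleton_iff.1 hk])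
  CRV_mem_C w := G.mem_nodeKer.1 (hQCRV.map_mem w) _ (by simp)
  CRV_mem_R w := G.mem_nodeKer.1 (hQCRV.map_mem w) _ (by simp)
  CRV_mem_V w := G.mem_nodeKer.1 (hQCRV.map_mem w) _ (by simp)
  CRV_id w h1 h2 h3 := hQCRV.map_id w (G.mem_nodeKer.2 fun k hk => by
    rcases hk with rfl | rfl | rfl <;> assumption)
  V_mem j := by
    have := hQVC.map_mem j
    rwa [LinearMap.mem_ker, Matrix.mulVecLin_apply, ← Matrix.mulVec_mulVec] at this
  V_id j hj := hQVC.map_id j (by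
    rw [LinearMap.mem_ker, Matrix.mulVecLin_apply, ← Matrix.mulVec_mulVec, hj])

/-- Voltage source currents in CV-loops do not see the potentials in `ker A_Cᵀ`. -/
theorem CircuitProjectors.transpose_V_mulVec (hQ : CircuitProjectors G QC QCRV QVC) (w : ν → ℝ) :
    QVCᵀ *ᵥ ((G.A .V)ᵀ *ᵥ (QC *ᵥ w)) = 0 := by
  rw [← dotProduct_self_eq_zero]
  rw [dotProduct_mulVec_eq, Matrix.transpose_transpose, dotProduct_mulVec_eq,
    Matrix.transpose_transpose, dotProduct_mulVec_eq, hQ.V_mem, zero_dotProduct]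

variable {δ : Type*}

theorem CircuitProjectors.componentMap_idem (hQ : CircuitProjectors G QC QCRV QVC)
    (z : CoupledState G δ) :
    componentMap G δ QCRV QVC (componentMap G δ QCRV QVC z) = componentMap G δ QCRV QVC z := by
  simp only [componentMap, LinearMap.coe_mk, AddHom.coe_mk]
  rw [hQ.CRV_id _ (hQ.CRV_mem_C _) (hQ.CRV_mem_R _) (hQ.CRV_mem_V _), hQ.V_id _ (hQ.V_mem _)]

end Projectors

/-! ### The coupled system -/

section CoupledSystem

variable {ν β δ : Type*} [Fintype ν] [DecidableEq ν] [Fintype δ] {G : CircuitGraph ν β}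

/-- The map `((e, …), t) ↦ (Aᵀ e, t)` to the argument of the constitutive function of a kind of
branches. -/
noncomputable def branchArg (G : CircuitGraph ν β) (δ : Type*) [Fintype δ] (k : BranchKind) :
    CoupledState G δ × ℝ →L[ℝ] (G.Br k → ℝ) × ℝ :=
  ((mulVecCLM (G.A k)ᵀ).comp ((ContinuousLinearMap.fst ℝ _ _).comp
    (ContinuousLinearMap.fst ℝ _ _))).prod (ContinuousLinearMap.snd ℝ _ _)

@[simp] theorem branchArg_apply (k : BranchKind) (p : CoupledState G δ × ℝ) :
    branchArg G δ k p = ((G.A k)ᵀ *ᵥ p.1.1, p.2) := rfl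

variable [Fintype β] (M : CircuitModel G)

/-- The currents of inductors, voltage sources and the element, summed up at the nodes. -/
noncomputable def linCurrents (G : CircuitGraph ν β) (δ : Type*) [Fintype δ] :
    CoupledState G δ →L[ℝ] (ν → ℝ) :=
  LinearMap.toContinuousLinearMap
    { toFun := fun z => G.A .L *ᵥ z.2.1 + G.A .V *ᵥ z.2.2.1 + G.A .lam *ᵥ z.2.2.2.2
      map_add' := fun y z => by
        simp only [Prod.fst_add, Prod.snd_add, Matrix.mulVec_add]
        abel
      map_smul' := fun c z => by
        simp [Matrix.mulVec_smul] }

theorem linCurrents_apply (z : CoupledState G δ) : linCurrents G δ z =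
    G.A .L *ᵥ z.2.1 + G.A .V *ᵥ z.2.2.1 + G.A .lam *ᵥ z.2.2.2.2 := rfl

/-- Kirchhoff's current law without the capacitive currents. -/
noncomputable def staticKCL (p : CoupledState G δ × ℝ) : ν → ℝ :=
  G.A .R *ᵥ M.g ((G.A .R)ᵀ *ᵥ p.1.1, p.2) + linCurrents G δ p.1 + G.A .I *ᵥ M.isrc p.2

/-- The derivative of `staticKCL`. -/
noncomputable def dStaticKCL (p : CoupledState G δ × ℝ) : CoupledState G δ × ℝ →L[ℝ] (ν → ℝ) :=
  (mulVecCLM (G.A .R)).comp ((fderiv ℝ M.g (branchArg G δ .R p)).comp (branchArg G δ .R))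
    + (linCurrents G δ).comp (ContinuousLinearMap.fst ℝ _ _)
    + (mulVecCLM (G.A .I)).comp ((fderiv ℝ M.isrc p.2).comp (ContinuousLinearMap.snd ℝ _ _))

variable {M}

theorem contDiff_staticKCL (hM : M.IsSmooth) :
    ContDiff ℝ ∞ (staticKCL M : CoupledState G δ × ℝ → ν → ℝ) := by
  obtain ⟨-, hg, -, hi, -⟩ := hM
  refine ContDiff.add (ContDiff.add ?_ ?_) ?_
  · exact (mulVecCLM (G.A .R)).contDiff.comp (hg.comp (branchArg G δ .R).contDiff)
  · exact (linCurrents G δ).contDiff.comp contDiff_fst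
  · exact (mulVecCLM (G.A .I)).contDiff.comp (hi.comp contDiff_snd)

theorem hasFDerivAt_staticKCL (hM : M.IsSmooth) (p : CoupledState G δ × ℝ) :
    HasFDerivAt (staticKCL M) (dStaticKCL M p) p := by
  obtain ⟨-, hg, -, hi, -⟩ := hM
  refine HasFDerivAt.add (HasFDerivAt.add ?_ ?_) ?_
  · exact (mulVecCLM (G.A .R)).hasFDerivAt.comp p
      ((hg.differentiable (by simp) _).hasFDerivAt.comp p (branchArg G δ .R).hasFDerivAt)
  · exact (linCurrents G δ).hasFDerivAt.comp p hasFDerivAt_fst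
  · exact (mulVecCLM (G.A .I)).hasFDerivAt.comp p
      ((hi.differentiable (by simp) _).hasFDerivAt.comp p hasFDerivAt_snd)

theorem contDiff_dStaticKCL (hM : M.IsSmooth) :
    ContDiff ℝ ∞ (dStaticKCL M : CoupledState G δ × ℝ → _) := by
  obtain ⟨-, hg, -, hi, -⟩ := hM
  refine ContDiff.add (ContDiff.add ?_ contDiff_const) ?_
  · exact contDiff_const.clm_comp (((contDiff_fderiv hg).comp
      (branchArg G δ .R).contDiff).clm_comp contDiff_const)
  · exact contDiff_const.clm_comp (((contDiff_fderiv hi).comp contDiff_snd).clm_comp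
      contDiff_const)

/-- The internal unknowns, the currents and the voltages of the element. -/
noncomputable def elementProj (G : CircuitGraph ν β) (δ : Type*) [Fintype δ] :
    CoupledState G δ →L[ℝ] (δ → ℝ) × (G.Br .lam → ℝ) × (G.Br .lam → ℝ) :=
  LinearMap.toContinuousLinearMap
    { toFun := fun z => (z.2.2.2.1, z.2.2.2.2, (G.A .lam)ᵀ *ᵥ z.1)
      map_add' := fun y z => by
        simp [Matrix.mulVec_add]
      map_smul' := fun c z => by
        simp [Matrix.mulVec_smul] }

theorem elementProj_apply (z : CoupledState G δ) :
    elementProj G δ z = (z.2.2.2.1, z.2.2.2.2, (G.A .lam)ᵀ *ᵥ z.1) := rfl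

theorem contDiff_elementArg (δ κ : Type*) [Fintype δ] [Fintype κ] : ContDiff ℝ ∞
    fun p : ((δ → ℝ) × (κ → ℝ) × (κ → ℝ)) × ((δ → ℝ) × (κ → ℝ) × (κ → ℝ)) × ℝ =>
      (p.1.1, p.1.2.1, p.2.1.1, p.2.1.2.1, p.2.1.2.2, p.2.2) := by
  fun_prop

theorem contDiff_elementDAE {κ : Type*} [Fintype κ] {F : ElementFun δ κ} (hF : ContDiff ℝ ∞ F) :
    ContDiff ℝ ∞ (triFun (elementDAE F)) :=
  hF.comp (contDiff_elementArg δ κ)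

variable {F : ElementFun δ (G.Br .lam)}

theorem coupledDAE_apply (y x : CoupledState G δ) (t : ℝ) : coupledDAE M F y x t =
    (G.A .C *ᵥ fderiv ℝ M.q ((G.A .C)ᵀ *ᵥ x.1, t) ((G.A .C)ᵀ *ᵥ y.1, 1) + staticKCL M (x, t),
      fderiv ℝ M.φL (x.2.1, t) (y.2.1, 1) - (G.A .L)ᵀ *ᵥ x.1,
      (G.A .V)ᵀ *ᵥ x.1 - M.vsrc t,
      F (y.2.2.2.1, y.2.2.2.2, x.2.2.2.1, x.2.2.2.2, (G.A .lam)ᵀ *ᵥ x.1, t)) := by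
  simp only [coupledDAE, staticKCL, linCurrents_apply, add_assoc]

theorem contDiff_coupledDAE (hM : M.IsSmooth) (hF : ContDiff ℝ ∞ F) :
    ContDiff ℝ ∞ (triFun (coupledDAE M F)) := by
  have h : triFun (coupledDAE M F) = fun p => _ := funext fun p => coupledDAE_apply p.1 p.2.1 p.2.2
  have hs := contDiff_staticKCL (δ := δ) hM
  obtain ⟨hq, -, hφ, -, hv⟩ := hM
  have hA : ∀ k, ContDiff ℝ ∞ fun w : ν → ℝ => (G.A k)ᵀ *ᵥ w := fun k =>
    (mulVecCLM (G.A k)ᵀ).contDiff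
  have hC : ContDiff ℝ ∞ fun w => G.A .C *ᵥ w := (mulVecCLM (G.A .C)).contDiff
  rw [h]
  refine ContDiff.prodMk ?_ (ContDiff.prodMk ?_ (ContDiff.prodMk ?_ ?_))
  · refine ContDiff.add (hC.comp (ContDiff.clm_apply ((contDiff_fderiv hq).comp
      (((hA .C).comp ?_).prodMk ?_)) (((hA .C).comp ?_).prodMk contDiff_const))) (hs.comp ?_)
      <;> fun_prop
  · refine ContDiff.sub (ContDiff.clm_apply ((contDiff_fderiv hφ).comp ?_) ?_) ((hA .L).comp ?_)
      <;> fun_prop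
  · exact ((hA .V).comp (by fun_prop)).sub (hv.comp (by fun_prop))
  · exact (contDiff_elementDAE hF).comp (((elementProj G δ).contDiff.comp contDiff_fst).prodMk
      (((elementProj G δ).contDiff.comp (contDiff_fst.comp contDiff_snd)).prodMk
        (contDiff_snd.comp contDiff_snd)))

/-- The coefficient of the index-2 components in the coupled system. -/
def componentCoeff (G : CircuitGraph ν β) (δ : Type*) [Fintype δ]
    (B : Matrix (δ ⊕ G.Br .lam) (G.Br .lam) ℝ) :
    CoupledState G δ →ₗ[ℝ] (ν → ℝ) × (G.Br .L → ℝ) × (G.Br .V → ℝ) × (δ ⊕ G.Br .lam → ℝ) where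
  toFun z := (G.A .V *ᵥ z.2.2.1, -((G.A .L)ᵀ *ᵥ z.1), 0, B *ᵥ ((G.A .lam)ᵀ *ᵥ z.1))
  map_add' y z := by
    simp only [Prod.fst_add, Prod.snd_add, Matrix.mulVec_add, neg_add, Prod.mk_add_mk, add_zero]
  map_smul' c z := by
    simp [Matrix.mulVec_smul]

theorem componentCoeff_apply (B : Matrix (δ ⊕ G.Br .lam) (G.Br .lam) ℝ) (z : CoupledState G δ) :
    componentCoeff G δ B z =
      (G.A .V *ᵥ z.2.2.1, -((G.A .L)ᵀ *ᵥ z.1), 0, B *ᵥ ((G.A .lam)ᵀ *ᵥ z.1)) := rfl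

variable {QC QCRV : Matrix ν ν ℝ} {QVC : Matrix (G.Br .V) (G.Br .V) ℝ}

theorem coupledDAE_sub_componentMap
    {Ft : (δ → ℝ) × (G.Br .lam → ℝ) × (δ → ℝ) × (G.Br .lam → ℝ) × ℝ → (δ ⊕ G.Br .lam → ℝ)}
    {B : Matrix (δ ⊕ G.Br .lam) (G.Br .lam) ℝ}
    (hlin : ∀ (x' : δ → ℝ) (i' : G.Br .lam → ℝ) (x : δ → ℝ) (i v : G.Br .lam → ℝ) (t : ℝ),
      F (x', i', x, i, v, t) = Ft (x', i', x, i, t) + B *ᵥ v)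
    (hQ : CircuitProjectors G QC QCRV QVC) (y x : CoupledState G δ) (t : ℝ) :
    coupledDAE M F y x t = coupledDAE M F (y - componentMap G δ QCRV QVC y)
      (x - componentMap G δ QCRV QVC x) t
      + componentCoeff G δ B (componentMap G δ QCRV QVC x) := by
  simp only [coupledDAE_apply, componentCoeff_apply, componentMap_apply, Prod.fst_sub,
    Prod.snd_sub, Matrix.mulVec_sub, staticKCL, linCurrents_apply, hQ.CRV_mem_C, hQ.CRV_mem_R,
    hQ.CRV_mem_V, sub_zero, Prod.mk_add_mk, add_zero, hlin, Prod.mk.injEq, true_and]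
  refine ⟨by abel, by abel, by abel⟩

end CoupledSystem

/-! ### Inductance-like elements -/

section ElementRate

variable {δ κ : Type*} [Fintype δ] [Fintype κ] {I : Set ℝ}
  {φ : (κ → ℝ) × (δ → ℝ) × ℝ → (κ → ℝ)}
  {fx : (δ → ℝ) × (κ → ℝ) × (κ → ℝ) × ℝ → (δ → ℝ)}
  {fφ : (δ → ℝ) × (κ → ℝ) × (κ → ℝ) × ℝ → (κ → ℝ)}

theorem dphi_di_eq (hφ : ContDiff ℝ ∞ φ) (i : κ → ℝ) (x : δ → ℝ) (t : ℝ) :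
    dphi_di φ i x t = (fderiv ℝ φ (i, x, t)).comp (ContinuousLinearMap.inl ℝ _ _) :=
  fderiv_partial_fst hφ i (x, t)

theorem fderiv_phi_apply (hφ : ContDiff ℝ ∞ φ) (i i' : κ → ℝ) (x x' : δ → ℝ) (t τ : ℝ) :
    fderiv ℝ φ (i, x, t) (i', x', τ) =
      dphi_di φ i x t i' + fderiv ℝ φ (i, x, t) (0, x', τ) := by
  rw [dphi_di_eq hφ, ContinuousLinearMap.comp_apply, ContinuousLinearMap.inl_apply, ← map_add]
  simp

theorem currentRate_eq (hφ : ContDiff ℝ ∞ φ) (x : δ → ℝ) (i v : κ → ℝ) (t : ℝ) :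
    currentRate φ fx fφ x i v t = (dphi_di φ i x t).inverse
      (fφ (x, i, v, t) - fderiv ℝ φ (i, x, t) (0, fx (x, i, v, t), 1)) := by
  have h0 : ContDiff ℝ ∞ (fun q : (δ → ℝ) × ℝ => φ (i, q)) :=
    hφ.comp (contDiff_const.prodMk contDiff_id)
  have h1 : fderiv ℝ (fun q : (δ → ℝ) × ℝ => φ (i, q)) (x, t)
      = (fderiv ℝ φ (i, x, t)).comp (ContinuousLinearMap.inr ℝ _ _) :=
    fderiv_partial_snd hφ i (x, t)
  have h2 := fderiv_partial_fst h0 x t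
  have h3 := congrArg (fun L => L 1) (fderiv_partial_snd h0 x t)
  simp only [fderiv_apply_one_eq_deriv] at h3
  unfold currentRate
  rw [h2, h3, h1]
  congr 1
  have h4 : ((0 : κ → ℝ), fx (x, i, v, t), (1 : ℝ))
      = (0, fx (x, i, v, t), 0) + (0, 0, 1) := by simp
  rw [h4, map_add]
  simp only [ContinuousLinearMap.comp_apply, ContinuousLinearMap.inl_apply,
    ContinuousLinearMap.inr_apply]
  abel

theorem contDiffOn_dphi_di_inverse (hφ : ContDiff ℝ ∞ φ)
    (hinv : ∀ i x, ∀ t ∈ I, (dphi_di φ i x t).IsInvertible) :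
    ContDiffOn ℝ ∞ (fun q : (κ → ℝ) × (δ → ℝ) × ℝ => (dphi_di φ q.1 q.2.1 q.2.2).inverse)
      {q | q.2.2 ∈ I} := by
  refine ContDiffOn.clm_inverse (ContDiff.contDiffOn ?_) fun q hq => hinv _ _ _ hq
  simp only [dphi_di_eq hφ]
  exact (contDiff_fderiv hφ).clm_comp contDiff_const

theorem contDiffOn_currentRate (hφ : ContDiff ℝ ∞ φ) (hfx : ContDiff ℝ ∞ fx)
    (hfφ : ContDiff ℝ ∞ fφ) (hinv : ∀ i x, ∀ t ∈ I, (dphi_di φ i x t).IsInvertible) :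
    ContDiffOn ℝ ∞ (fun q : (δ → ℝ) × (κ → ℝ) × (κ → ℝ) × ℝ =>
      currentRate φ fx fφ q.1 q.2.1 q.2.2.1 q.2.2.2) {q | q.2.2.2 ∈ I} := by
  have harg : ContDiff ℝ ∞ fun q : (δ → ℝ) × (κ → ℝ) × (κ → ℝ) × ℝ =>
    (q.2.1, q.1, q.2.2.2) := by fun_prop
  simp only [currentRate_eq hφ]
  refine ContDiffOn.clm_apply ((contDiffOn_dphi_di_inverse hφ hinv).comp harg.contDiffOn
    fun q hq => hq) (ContDiff.contDiffOn ?_)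
  exact hfφ.sub (((contDiff_fderiv hφ).comp harg).clm_apply
    (contDiff_const.prodMk (hfx.prodMk contDiff_const)))

end ElementRate

/-! ### Components determined after one differentiation -/

/-- Solving an equation that is affine in `x'`, up to the constant kernel of its leading
coefficient. -/
theorem ObtainedBy.exists_determined {X W U : Type*} [NormedAddCommGroup X] [NormedSpace ℝ X]
    [FiniteDimensional ℝ X] [NormedAddCommGroup W] [NormedSpace ℝ W] [NormedAddCommGroup U]
    [NormedSpace ℝ U] [FiniteDimensional ℝ U] {I : Set ℝ} {F : X → X → ℝ → W} {m : ℕ}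
    {S : X × ℝ → X →L[ℝ] U} {r : X × ℝ → U}
    (h : ObtainedBy I F m (fun y x t => S (x, t) y + r (x, t)))
    (hS : ContDiffOn ℝ ∞ S (Set.univ ×ˢ I)) (hr : ContDiffOn ℝ ∞ r (Set.univ ×ˢ I))
    (T : X →ₗ[ℝ] X) (hT : ∀ y, T (T y) = T y)
    (hker : ∀ x, ∀ t ∈ I, ∀ y, S (x, t) y = 0 ↔ T y = y) :
    ∃ Φ : X × ℝ → X, ContDiffOn ℝ ∞ Φ (Set.univ ×ˢ I) ∧
      ObtainedBy I F m (fun y x t => y - T y - Φ (x, t)) := by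
  obtain ⟨K, hK, hKS⟩ := exists_contDiffOn_leftInverse hS T hT
    fun p hp => hker p.1 p.2 hp.2
  refine ⟨fun p => -K p (r p), (hK.clm_apply hr).neg, (h.clm_apply hK).congr fun y x t ht => ?_⟩
  rw [map_add, hKS _ ⟨trivial, ht⟩, sub_neg_eq_add]

section Coupled

variable {ν β δ : Type*} [Fintype ν] [DecidableEq ν] [Fintype β] [Fintype δ]
  {G : CircuitGraph ν β} {M : CircuitModel G} {F : ElementFun δ (G.Br .lam)} {I : Set ℝ}
  {QC QCRV : Matrix ν ν ℝ} {QVC : Matrix (G.Br .V) (G.Br .V) ℝ}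

theorem obtainedBy_KCL : ObtainedBy I (coupledDAE M F) 0 (fun y x t =>
    G.A .C *ᵥ fderiv ℝ M.q ((G.A .C)ᵀ *ᵥ x.1, t) ((G.A .C)ᵀ *ᵥ y.1, 1) + staticKCL M (x, t)) :=
  (obtainedBy_self.clm (ContinuousLinearMap.fst ℝ _ _)).congr fun y x t _ => by
    rw [coupledDAE_apply]
    rfl

theorem obtainedBy_inductor : ObtainedBy I (coupledDAE M F) 0 (fun y x t =>
    fderiv ℝ M.φL (x.2.1, t) (y.2.1, 1) - (G.A .L)ᵀ *ᵥ x.1) :=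
  (obtainedBy_self.clm ((ContinuousLinearMap.fst ℝ _ _).comp
    (ContinuousLinearMap.snd ℝ _ _))).congr fun y x t _ => by
    rw [coupledDAE_apply]
    rfl

theorem obtainedBy_source : ObtainedBy I (coupledDAE M F) 0 (fun _ x t =>
    (G.A .V)ᵀ *ᵥ x.1 - M.vsrc t) :=
  (obtainedBy_self.clm ((ContinuousLinearMap.fst ℝ _ _).comp
    ((ContinuousLinearMap.snd ℝ _ _).comp (ContinuousLinearMap.snd ℝ _ _)))).congr
    fun y x t _ => by
    rw [coupledDAE_apply]
    rfl

theorem obtainedBy_deriv_source (hI : UniqueDiffOn ℝ I) (hM : M.IsSmooth) (hF : ContDiff ℝ ∞ F) :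
    ObtainedBy I (coupledDAE M F) 1 (fun y _ t => (G.A .V)ᵀ *ᵥ y.1 - fderiv ℝ M.vsrc t 1) :=
  (obtainedBy_source (M := M) (F := F)).deriv hI (contDiff_coupledDAE hM hF)
    (h := fun p => (G.A .V)ᵀ *ᵥ p.1.1 - M.vsrc p.2)
    (D := fun p => (mulVecCLM (G.A .V)ᵀ).comp ((ContinuousLinearMap.fst ℝ _ _).comp
      (ContinuousLinearMap.fst ℝ _ _)) - (fderiv ℝ M.vsrc p.2).comp (ContinuousLinearMap.snd ℝ _ _))
    fun x t _ => by
      refine HasFDerivAt.hasFDerivWithinAt (HasFDerivAt.sub ?_ ?_)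
      · exact (mulVecCLM (G.A .V)ᵀ).hasFDerivAt.comp (x, t)
          (hasFDerivAt_fst.comp (x, t) hasFDerivAt_fst)
      · exact (hM.2.2.2.2.differentiable (by simp) _).hasFDerivAt.comp (x, t) hasFDerivAt_snd

/-- Kirchhoff's current law, projected along the capacitive branches, contains no derivatives, so
it may be differentiated. -/
theorem obtainedBy_deriv_KCL (hI : UniqueDiffOn ℝ I) (hM : M.IsSmooth) (hF : ContDiff ℝ ∞ F)
    {Q : Matrix ν ν ℝ} (hQ : ∀ w, (G.A .C)ᵀ *ᵥ (Q *ᵥ w) = 0) :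
    ObtainedBy I (coupledDAE M F) 1 (fun y x t => Qᵀ *ᵥ dStaticKCL M (x, t) (y, 1)) := by
  have h0 : ObtainedBy I (coupledDAE M F) 0 (fun _ x t => Qᵀ *ᵥ staticKCL M (x, t)) :=
    (obtainedBy_KCL.clm (mulVecCLM Qᵀ)).congr fun y x t _ => by
      rw [mulVecCLM_apply, Matrix.mulVec_add, transpose_mulVec_eq_zero hQ, zero_add]
  exact h0.deriv hI (contDiff_coupledDAE hM hF)
    (h := fun p => Qᵀ *ᵥ staticKCL M p) (D := fun p => (mulVecCLM Qᵀ).comp (dStaticKCL M p))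
    fun x t _ => ((mulVecCLM Qᵀ).hasFDerivAt.comp (x, t)
      (hasFDerivAt_staticKCL hM (x, t))).hasFDerivWithinAt

variable {φ : (G.Br .lam → ℝ) × (δ → ℝ) × ℝ → (G.Br .lam → ℝ)}
  {fx : (δ → ℝ) × (G.Br .lam → ℝ) × (G.Br .lam → ℝ) × ℝ → (δ → ℝ)}
  {fφ : (δ → ℝ) × (G.Br .lam → ℝ) × (G.Br .lam → ℝ) × ℝ → (G.Br .lam → ℝ)}

theorem obtainedBy_element (hM : M.IsSmooth) (hF : ContDiff ℝ ∞ F)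
    (hel : ObtainedBy I (elementDAE F) 1 (reducedElementDAE φ fx fφ)) :
    ObtainedBy I (coupledDAE M F) 1 (fun y x t =>
      reducedElementDAE φ fx fφ (elementProj G δ y) (elementProj G δ x) t) :=
  hel.transfer (contDiff_coupledDAE hM hF) (elementProj G δ)
    ((ContinuousLinearMap.snd ℝ _ _).comp
      ((ContinuousLinearMap.snd ℝ _ _).comp (ContinuousLinearMap.snd ℝ _ _)))
    fun y x t => by
      rw [coupledDAE_apply]
      rfl

/-- The arguments `(x, i, v, t)` of the right-hand sides of the element. -/
noncomputable def rateArg (G : CircuitGraph ν β) (δ : Type*) [Fintype δ] :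
    CoupledState G δ × ℝ →L[ℝ] (δ → ℝ) × (G.Br .lam → ℝ) × (G.Br .lam → ℝ) × ℝ :=
  LinearMap.toContinuousLinearMap
    { toFun := fun p => (p.1.2.2.2.1, p.1.2.2.2.2, (G.A .lam)ᵀ *ᵥ p.1.1, p.2)
      map_add' := fun y z => by
        simp [Matrix.mulVec_add]
      map_smul' := fun c z => by
        simp [Matrix.mulVec_smul] }

theorem rateArg_apply (p : CoupledState G δ × ℝ) :
    rateArg G δ p = (p.1.2.2.2.1, p.1.2.2.2.2, (G.A .lam)ᵀ *ᵥ p.1.1, p.2) := rfl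

variable (M) in
/-- The coefficient of `x'` in the equations of the coupled system, the differentiated voltage
source equations, the reduced element equations and the differentiated `QCᵀ`-part of Kirchhoff's
current law. -/
noncomputable def leadingCoeff (QC : Matrix ν ν ℝ)
    (φ : (G.Br .lam → ℝ) × (δ → ℝ) × ℝ → (G.Br .lam → ℝ)) (p : CoupledState G δ × ℝ) :
    CoupledState G δ →L[ℝ] (ν → ℝ) × (G.Br .L → ℝ) × (G.Br .V → ℝ) ×
      ((δ → ℝ) × (G.Br .lam → ℝ)) × (ν → ℝ) :=
  ((mulVecCLM (G.A .C)).comp ((fderiv ℝ M.q ((G.A .C)ᵀ *ᵥ p.1.1, p.2)).comp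
      ((ContinuousLinearMap.inl ℝ _ _).comp ((mulVecCLM (G.A .C)ᵀ).comp
        (ContinuousLinearMap.fst ℝ _ _))))).prod
    (((fderiv ℝ M.φL (p.1.2.1, p.2)).comp ((ContinuousLinearMap.inl ℝ _ _).comp
      ((ContinuousLinearMap.fst ℝ _ _).comp (ContinuousLinearMap.snd ℝ _ _)))).prod
    (((mulVecCLM (G.A .V)ᵀ).comp (ContinuousLinearMap.fst ℝ _ _)).prod
    ((((ContinuousLinearMap.fst ℝ _ _).comp (elementProj G δ)).prod
      ((fderiv ℝ φ (p.1.2.2.2.2, p.1.2.2.2.1, p.2)).comp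
        (((ContinuousLinearMap.fst ℝ _ _).comp ((ContinuousLinearMap.snd ℝ _ _).comp
          (elementProj G δ))).prod
        (((ContinuousLinearMap.fst ℝ _ _).comp (elementProj G δ)).prod 0)))).prod
    ((mulVecCLM QCᵀ).comp ((dStaticKCL M p).comp (ContinuousLinearMap.inl ℝ _ _))))))

theorem leadingCoeff_apply (p : CoupledState G δ × ℝ) (y : CoupledState G δ) :
    leadingCoeff M QC φ p y =
      (G.A .C *ᵥ fderiv ℝ M.q ((G.A .C)ᵀ *ᵥ p.1.1, p.2) ((G.A .C)ᵀ *ᵥ y.1, 0),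
        fderiv ℝ M.φL (p.1.2.1, p.2) (y.2.1, 0),
        (G.A .V)ᵀ *ᵥ y.1,
        (y.2.2.2.1, fderiv ℝ φ (p.1.2.2.2.2, p.1.2.2.2.1, p.2) (y.2.2.2.2, y.2.2.2.1, 0)),
        QCᵀ *ᵥ dStaticKCL M p (y, 0)) := rfl

theorem contDiff_mulVec {X ι κ : Type*} [NormedAddCommGroup X] [NormedSpace ℝ X] [Fintype ι]
    [Fintype κ] (A : Matrix κ ι ℝ) {f : X → ι → ℝ} (hf : ContDiff ℝ ∞ f) :
    ContDiff ℝ ∞ fun x => A *ᵥ f x :=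
  (mulVecCLM A).contDiff.comp hf

theorem ContDiffOn.mulVec {X ι κ : Type*} [NormedAddCommGroup X] [NormedSpace ℝ X] [Fintype ι]
    [Fintype κ] {s : Set X} (A : Matrix κ ι ℝ) {f : X → ι → ℝ} (hf : ContDiffOn ℝ ∞ f s) :
    ContDiffOn ℝ ∞ (fun x => A *ᵥ f x) s :=
  (mulVecCLM A).contDiff.comp_contDiffOn hf

theorem contDiff_branchArg (k : BranchKind) : ContDiff ℝ ∞ (fun p : CoupledState G δ × ℝ =>
    ((G.A k)ᵀ *ᵥ p.1.1, p.2)) := (branchArg G δ k).contDiff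

theorem contDiff_leadingCoeff (hM : M.IsSmooth) (hφ : ContDiff ℝ ∞ φ) :
    ContDiff ℝ ∞ (leadingCoeff M QC φ : CoupledState G δ × ℝ → _) := by
  have hs := contDiff_dStaticKCL (δ := δ) hM
  obtain ⟨hq, -, hφL, -, -⟩ := hM
  refine contDiff_clm_apply_iff.2 fun y => ?_
  simp only [leadingCoeff_apply]
  refine ContDiff.prodMk ?_ (ContDiff.prodMk ?_ (ContDiff.prodMk contDiff_const
    (ContDiff.prodMk (contDiff_const.prodMk ?_) ?_)))
  · exact contDiff_mulVec _ (((contDiff_fderiv hq).comp (contDiff_branchArg .C)).clm_apply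
      contDiff_const)
  · exact ((contDiff_fderiv hφL).comp (by fun_prop)).clm_apply contDiff_const
  · exact ((contDiff_fderiv hφ).comp (by fun_prop)).clm_apply contDiff_const
  · exact contDiff_mulVec _ (hs.clm_apply contDiff_const)

variable (hwp : M.WellPosed I) (hQ : CircuitProjectors G QC QCRV QVC)

include hwp

theorem CircuitModel.WellPosed.posDef_fderiv_q (hM : M.IsSmooth) (v : G.Br .C → ℝ) {t : ℝ}
    (ht : t ∈ I) : IsPosDefOp ((fderiv ℝ M.q (v, t)).comp (ContinuousLinearMap.inl ℝ _ _)) := by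
  rw [← fderiv_partial_fst hM.1]
  exact hwp.posDef_C v t ht

theorem CircuitModel.WellPosed.posDef_fderiv_g (hM : M.IsSmooth) (v : G.Br .R → ℝ) {t : ℝ}
    (ht : t ∈ I) : IsPosDefOp ((fderiv ℝ M.g (v, t)).comp (ContinuousLinearMap.inl ℝ _ _)) := by
  rw [← fderiv_partial_fst hM.2.1]
  exact hwp.posDef_G v t ht

theorem CircuitModel.WellPosed.posDef_fderiv_φL (hM : M.IsSmooth) (i : G.Br .L → ℝ) {t : ℝ}
    (ht : t ∈ I) : IsPosDefOp ((fderiv ℝ M.φL (i, t)).comp (ContinuousLinearMap.inl ℝ _ _)) := by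
  rw [← fderiv_partial_fst hM.2.2.1]
  exact hwp.posDef_L i t ht

include hQ

/-- The part of the unknowns that the equations available after one differentiation do not
determine consists of the potentials `QCRV e` and the currents `QVC i_V`. -/
theorem leadingCoeff_eq_zero_iff (hM : M.IsSmooth) (hφ : ContDiff ℝ ∞ φ)
    (hinv : ∀ i x, ∀ t ∈ I, (dphi_di φ i x t).IsInvertible) (x : CoupledState G δ) {t : ℝ}
    (ht : t ∈ I) (y : CoupledState G δ) :
    leadingCoeff M QC φ (x, t) y = 0 ↔ componentMap G δ QCRV QVC y = y := by
  obtain ⟨e, iL, iV, z, i⟩ := y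
  simp only [leadingCoeff_apply, componentMap_apply, Prod.mk_eq_zero, Prod.mk.injEq, dStaticKCL,
    linCurrents_apply, add_apply, ContinuousLinearMap.comp_apply, ContinuousLinearMap.coe_fst',
    ContinuousLinearMap.coe_snd', branchArg_apply, mulVecCLM_apply, map_zero, add_zero]
  constructor
  · rintro ⟨h1, h2, h3, ⟨rfl, h4⟩, h5⟩
    have hC : (G.A .C)ᵀ *ᵥ e = 0 := by
      refine (hwp.posDef_fderiv_q hM ((G.A .C)ᵀ *ᵥ x.1) ht).eq_zero (le_of_eq ?_)
      rw [← dotProduct_mulVec_eq]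
      exact (congrArg _ h1).trans (dotProduct_zero _)
    have hL : iL = 0 := (hwp.posDef_fderiv_φL hM x.2.1 ht).eq_zero
      ((congrArg _ h2).trans (dotProduct_zero _)).le
    have hi : i = 0 := by
      rw [fderiv_phi_apply hφ] at h4
      have h0 : ((0 : G.Br .lam → ℝ), (0 : δ → ℝ), (0 : ℝ)) = 0 := rfl
      rw [h0, map_zero, add_zero] at h4
      exact (hinv _ _ _ ht).injective (h4.trans (map_zero _).symm)
    subst hL hi
    simp only [Matrix.mulVec_zero, add_zero, zero_add] at h5
    have hQe := hQ.C_id e hC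
    -- pairing the last row with `e = QC e` removes the source currents, as `A_Vᵀ e = 0`
    have hR : (G.A .R)ᵀ *ᵥ e = 0 := by
      refine (hwp.posDef_fderiv_g hM ((G.A .R)ᵀ *ᵥ x.1) ht).eq_zero (le_of_eq ?_)
      have h6 := congrArg (fun v => e ⬝ᵥ v) h5
      simp only [dotProduct_zero] at h6
      rw [dotProduct_mulVec_eq, Matrix.transpose_transpose, hQe, dotProduct_add,
        dotProduct_mulVec_eq, dotProduct_mulVec_eq, h3, zero_dotProduct, add_zero] at h6
      exact h6
    refine ⟨hQ.CRV_id e hC hR h3, rfl, hQ.V_id iV ?_, rfl, rfl⟩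
    have h0 : (((G.A .R)ᵀ *ᵥ e, (0 : ℝ)) : (G.Br .R → ℝ) × ℝ) = 0 := by rw [hR]; rfl
    rwa [h0, map_zero, Matrix.mulVec_zero, zero_add] at h5
  · rintro ⟨h1, rfl, h2, rfl, rfl⟩
    have hC := hQ.CRV_mem_C e
    have hR := hQ.CRV_mem_R e
    have hV := hQ.CRV_mem_V e
    have hj := hQ.V_mem iV
    rw [h1] at hC hR hV
    rw [h2] at hj
    simp only [hC, hR, hV, Prod.mk_zero_zero, map_zero, Matrix.mulVec_zero, zero_add, add_zero, hj, true_and]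

/-- All components that `componentMap` annihilates are determined after one differentiation, by
a smooth right-hand side. -/
theorem exists_determined_after_one (hI : UniqueDiffOn ℝ I) (hM : M.IsSmooth)
    (hF : ContDiff ℝ ∞ F) (hφ : ContDiff ℝ ∞ φ) (hfx : ContDiff ℝ ∞ fx) (hfφ : ContDiff ℝ ∞ fφ)
    (hel : ObtainedBy I (elementDAE F) 1 (reducedElementDAE φ fx fφ))
    (hinv : ∀ i x, ∀ t ∈ I, (dphi_di φ i x t).IsInvertible) :
    ∃ Φ : CoupledState G δ × ℝ → CoupledState G δ, ContDiffOn ℝ ∞ Φ (Set.univ ×ˢ I) ∧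
      ObtainedBy I (coupledDAE M F) 1
        (fun y x t => y - componentMap G δ QCRV QVC y - Φ (x, t)) := by
  have hFc := contDiff_coupledDAE hM hF
  -- the part of the equations that does not contain `x'`
  let r : CoupledState G δ × ℝ → (ν → ℝ) × (G.Br .L → ℝ) × (G.Br .V → ℝ) ×
      ((δ → ℝ) × (G.Br .lam → ℝ)) × (ν → ℝ) := fun p =>
    (G.A .C *ᵥ fderiv ℝ M.q ((G.A .C)ᵀ *ᵥ p.1.1, p.2) (0, 1) + staticKCL M p,
      fderiv ℝ M.φL (p.1.2.1, p.2) (0, 1) - (G.A .L)ᵀ *ᵥ p.1.1,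
      -fderiv ℝ M.vsrc p.2 1,
      (-fx (rateArg G δ p), fderiv ℝ φ (p.1.2.2.2.2, p.1.2.2.2.1, p.2) (0, 0, 1)
        - fφ (rateArg G δ p)),
      QCᵀ *ᵥ dStaticKCL M p (0, 1))
  have hr : ContDiff ℝ ∞ r := by
    have hs := contDiff_staticKCL (δ := δ) hM
    have hds := contDiff_dStaticKCL (δ := δ) hM
    obtain ⟨hq, -, hφL, -, hv⟩ := hM
    refine ContDiff.prodMk ?_ (ContDiff.prodMk ?_ (ContDiff.prodMk ?_
      (ContDiff.prodMk (ContDiff.prodMk ?_ ?_) ?_)))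
    · exact (contDiff_mulVec _ (((contDiff_fderiv hq).comp (contDiff_branchArg .C)).clm_apply
        contDiff_const)).add hs
    · exact (((contDiff_fderiv hφL).comp (by fun_prop)).clm_apply contDiff_const).sub
        (contDiff_mulVec _ (by fun_prop))
    · exact (((contDiff_fderiv hv).comp contDiff_snd).clm_apply contDiff_const).neg
    · exact (hfx.comp (rateArg G δ).contDiff).neg
    · exact (((contDiff_fderiv hφ).comp (by fun_prop)).clm_apply contDiff_const).sub
        (hfφ.comp (rateArg G δ).contDiff)
    · exact contDiff_mulVec _ (hds.clm_apply contDiff_const)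
  have hobt := (obtainedBy_KCL.succ hFc).prodMk ((obtainedBy_inductor.succ hFc).prodMk
    ((obtainedBy_deriv_source hI hM hF).prodMk ((obtainedBy_element hM hF hel).prodMk
      (obtainedBy_deriv_KCL hI hM hF hQ.C_mem))))
  refine ObtainedBy.exists_determined (S := leadingCoeff M QC φ) (r := r) (hobt.congr ?_)
    (contDiff_leadingCoeff hM hφ).contDiffOn hr.contDiffOn _ hQ.componentMap_idem
    fun x t ht y => leadingCoeff_eq_zero_iff hwp hQ hM hφ hinv x ht y
  intro y x t ht
  have h3 : fderiv ℝ φ (x.2.2.2.2, x.2.2.2.1, t) (y.2.2.2.2, y.2.2.2.1, 1) =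
      fderiv ℝ φ (x.2.2.2.2, x.2.2.2.1, t) (y.2.2.2.2, y.2.2.2.1, 0)
        + fderiv ℝ φ (x.2.2.2.2, x.2.2.2.1, t) (0, 0, 1) := by
    rw [← map_add]
    simp
  simp only [leadingCoeff_apply, r, reducedElementDAE, elementProj_apply, rateArg_apply,
    Prod.mk_add_mk]
  rw [fderiv_apply_split _ ((G.A .C)ᵀ *ᵥ y.1) 1, fderiv_apply_split _ y.2.1 1,
    fderiv_apply_split _ y 1, h3]
  simp only [Matrix.mulVec_add, Prod.mk.injEq]
  refine ⟨by abel, by abel, by abel, ⟨by abel, by abel⟩, trivial⟩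

end Coupled

/-! ### The hidden algebraic constraints -/

section Hidden

variable {ν β δ : Type*} [Fintype ν] [DecidableEq ν] [Fintype β] [Fintype δ]
  {G : CircuitGraph ν β} (M : CircuitModel G) {F : ElementFun δ (G.Br .lam)} {I : Set ℝ}
  (QC QCRV : Matrix ν ν ℝ) (QVC : Matrix (G.Br .V) (G.Br .V) ℝ)
  (φ : (G.Br .lam → ℝ) × (δ → ℝ) × ℝ → (G.Br .lam → ℝ))
  (fx : (δ → ℝ) × (G.Br .lam → ℝ) × (G.Br .lam → ℝ) × ℝ → (δ → ℝ))
  (fφ : (δ → ℝ) × (G.Br .lam → ℝ) × (G.Br .lam → ℝ) × ℝ → (G.Br .lam → ℝ))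

/-- The inverse of the inductance operator `∂φ_L/∂i_L`. -/
noncomputable def inductanceInv (p : CoupledState G δ × ℝ) :
    (G.Br .L → ℝ) →L[ℝ] (G.Br .L → ℝ) :=
  ((fderiv ℝ M.φL (p.1.2.1, p.2)).comp (ContinuousLinearMap.inl ℝ _ _)).inverse

/-- The inverse of the regularised capacitive nodal matrix `A_C (∂q/∂v) A_Cᵀ + QCᵀ QC`. -/
noncomputable def capacitiveInv (p : CoupledState G δ × ℝ) : (ν → ℝ) →L[ℝ] (ν → ℝ) :=
  (nodalOp (G.A .C) QC ((fderiv ℝ M.q ((G.A .C)ᵀ *ᵥ p.1.1, p.2)).comp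
    (ContinuousLinearMap.inl ℝ _ _))).inverse

/-- The differentiated Kirchhoff law of the LIλ-cutsets, with `i_L'` and `i_λ'` replaced by their
expressions in terms of the unknowns: a constraint for the potentials `QCRV e`. -/
noncomputable def cutsetConstraint (p : CoupledState G δ × ℝ) : ν → ℝ :=
  QCRVᵀ *ᵥ (G.A .L *ᵥ inductanceInv M p ((G.A .L)ᵀ *ᵥ p.1.1 - fderiv ℝ M.φL (p.1.2.1, p.2) (0, 1))
    + G.A .lam *ᵥ currentRate φ fx fφ (rateArg G δ p).1 (rateArg G δ p).2.1
        (rateArg G δ p).2.2.1 (rateArg G δ p).2.2.2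
    + G.A .I *ᵥ fderiv ℝ M.isrc p.2 1)

/-- The differentiated voltage law of the CV-loops, with `A_Cᵀ e'` replaced by its expression in
terms of the unknowns: a constraint for the currents `QVC i_V`. -/
noncomputable def loopConstraint (p : CoupledState G δ × ℝ) : G.Br .V → ℝ :=
  QVCᵀ *ᵥ ((G.A .V)ᵀ *ᵥ capacitiveInv M QC p
    (-(G.A .C *ᵥ fderiv ℝ M.q ((G.A .C)ᵀ *ᵥ p.1.1, p.2) (0, 1) + staticKCL M p))
    - fderiv ℝ M.vsrc p.2 1)

variable {M QC QCRV QVC φ fx fφ}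

theorem contDiffOn_inductanceInv (hM : M.IsSmooth) (hwp : M.WellPosed I) :
    ContDiffOn ℝ ∞ (inductanceInv M : CoupledState G δ × ℝ → _) (Set.univ ×ˢ I) := by
  refine ContDiffOn.clm_inverse (ContDiff.contDiffOn ?_)
    fun p hp => (hwp.posDef_fderiv_φL hM _ hp.2).isInvertible
  exact ((contDiff_fderiv hM.2.2.1).comp (by fun_prop)).clm_comp contDiff_const

theorem contDiffOn_capacitiveInv (hM : M.IsSmooth) (hwp : M.WellPosed I)
    (hQ : CircuitProjectors G QC QCRV QVC) :
    ContDiffOn ℝ ∞ (capacitiveInv M QC : CoupledState G δ × ℝ → _) (Set.univ ×ˢ I) := by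
  refine ContDiffOn.clm_inverse (ContDiff.contDiffOn ?_) fun p hp =>
    (isPosDefOp_nodalOp (hwp.posDef_fderiv_q hM _ hp.2) hQ.C_id).isInvertible
  exact (contDiff_const.clm_comp ((((contDiff_fderiv hM.1).comp
    (contDiff_branchArg .C)).clm_comp contDiff_const).clm_comp contDiff_const)).add contDiff_const

theorem contDiffOn_cutsetConstraint (hM : M.IsSmooth) (hwp : M.WellPosed I) (hφ : ContDiff ℝ ∞ φ)
    (hfx : ContDiff ℝ ∞ fx) (hfφ : ContDiff ℝ ∞ fφ)
    (hinv : ∀ i x, ∀ t ∈ I, (dphi_di φ i x t).IsInvertible) :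
    ContDiffOn ℝ ∞ (cutsetConstraint M QCRV φ fx fφ) (Set.univ ×ˢ I) := by
  refine ContDiffOn.mulVec _ (ContDiffOn.add (ContDiffOn.add (ContDiffOn.mulVec _ ?_)
    (ContDiffOn.mulVec _ ?_)) (ContDiffOn.mulVec _ ?_))
  · refine (contDiffOn_inductanceInv hM hwp).clm_apply (ContDiff.contDiffOn ?_)
    exact (contDiff_mulVec _ (by fun_prop)).sub
      (((contDiff_fderiv hM.2.2.1).comp (by fun_prop)).clm_apply contDiff_const)
  · exact (contDiffOn_currentRate hφ hfx hfφ hinv).comp (rateArg G δ).contDiff.contDiffOn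
      fun p hp => hp.2
  · exact (((contDiff_fderiv hM.2.2.2.1).comp contDiff_snd).clm_apply contDiff_const).contDiffOn

theorem contDiffOn_loopConstraint (hM : M.IsSmooth) (hwp : M.WellPosed I)
    (hQ : CircuitProjectors G QC QCRV QVC) :
    ContDiffOn ℝ ∞ (loopConstraint M QC QVC : CoupledState G δ × ℝ → _) (Set.univ ×ˢ I) := by
  refine ContDiffOn.mulVec _ (ContDiffOn.sub (ContDiffOn.mulVec _ ?_) ?_)
  · refine (contDiffOn_capacitiveInv hM hwp hQ).clm_apply (ContDiff.contDiffOn ?_)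
    exact ((contDiff_mulVec _ (((contDiff_fderiv hM.1).comp (contDiff_branchArg .C)).clm_apply
      contDiff_const)).add (contDiff_staticKCL hM)).neg
  · exact (((contDiff_fderiv hM.2.2.2.2).comp contDiff_snd).clm_apply contDiff_const).contDiffOn

/-- The element yields `i_λ' = (∂φ/∂i)⁻¹ (…)`. -/
theorem obtainedBy_current (hM : M.IsSmooth) (hF : ContDiff ℝ ∞ F) (hφ : ContDiff ℝ ∞ φ)
    (hel : ObtainedBy I (elementDAE F) 1 (reducedElementDAE φ fx fφ))
    (hinv : ∀ i x, ∀ t ∈ I, (dphi_di φ i x t).IsInvertible) :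
    ObtainedBy I (coupledDAE M F) 1 (fun y x t => y.2.2.2.2 -
      currentRate φ fx fφ x.2.2.2.1 x.2.2.2.2 ((G.A .lam)ᵀ *ᵥ x.1) t) := by
  let ε : (δ → ℝ) →L[ℝ] (G.Br .lam → ℝ) × (δ → ℝ) × ℝ :=
    (ContinuousLinearMap.inr ℝ _ _).comp (ContinuousLinearMap.inl ℝ _ _)
  have hK : ContDiffOn ℝ ∞ (fun p : CoupledState G δ × ℝ =>
      (dphi_di φ p.1.2.2.2.2 p.1.2.2.2.1 p.2).inverse.comp
        (ContinuousLinearMap.snd ℝ (δ → ℝ) (G.Br .lam → ℝ)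
          - ((fderiv ℝ φ (p.1.2.2.2.2, p.1.2.2.2.1, p.2)).comp ε).comp
            (ContinuousLinearMap.fst ℝ _ _))) (Set.univ ×ˢ I) := by
    have harg : ContDiff ℝ ∞ fun p : CoupledState G δ × ℝ =>
      (p.1.2.2.2.2, p.1.2.2.2.1, p.2) := by fun_prop
    refine ((contDiffOn_dphi_di_inverse hφ hinv).comp harg.contDiffOn fun p hp => hp.2).clm_comp
      (ContDiff.contDiffOn ?_)
    exact contDiff_const.sub ((((contDiff_fderiv hφ).comp harg).clm_comp contDiff_const).clm_comp
      contDiff_const)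
  refine ((obtainedBy_element hM hF hel).clm_apply hK).congr fun y x t ht => ?_
  have hi := hinv x.2.2.2.2 x.2.2.2.1 t ht
  have h1 : fderiv ℝ φ (x.2.2.2.2, x.2.2.2.1, t) (0, y.2.2.2.1, 1)
      - fderiv ℝ φ (x.2.2.2.2, x.2.2.2.1, t)
        (0, y.2.2.2.1 - fx (x.2.2.2.1, x.2.2.2.2, (G.A .lam)ᵀ *ᵥ x.1, t), 0)
      = fderiv ℝ φ (x.2.2.2.2, x.2.2.2.1, t)
        (0, fx (x.2.2.2.1, x.2.2.2.2, (G.A .lam)ᵀ *ᵥ x.1, t), 1) := by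
    rw [← map_sub]
    simp
  change _ = (dphi_di φ x.2.2.2.2 x.2.2.2.1 t).inverse
    ((fderiv ℝ φ (x.2.2.2.2, x.2.2.2.1, t) (y.2.2.2.2, y.2.2.2.1, 1)
        - fφ (x.2.2.2.1, x.2.2.2.2, (G.A .lam)ᵀ *ᵥ x.1, t))
      - fderiv ℝ φ (x.2.2.2.2, x.2.2.2.1, t)
        (0, y.2.2.2.1 - fx (x.2.2.2.1, x.2.2.2.2, (G.A .lam)ᵀ *ᵥ x.1, t), 0))
  rw [currentRate_eq hφ, fderiv_phi_apply hφ _ y.2.2.2.2 _ y.2.2.2.1, ← h1]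
  conv_lhs => rw [← hi.inverse_apply_self y.2.2.2.2, ← map_sub]
  congr 1
  abel

theorem obtainedBy_cutsetConstraint (hI : UniqueDiffOn ℝ I) (hM : M.IsSmooth)
    (hwp : M.WellPosed I) (hQ : CircuitProjectors G QC QCRV QVC)
    (hF : ContDiff ℝ ∞ F) (hφ : ContDiff ℝ ∞ φ)
    (hel : ObtainedBy I (elementDAE F) 1 (reducedElementDAE φ fx fφ))
    (hinv : ∀ i x, ∀ t ∈ I, (dphi_di φ i x t).IsInvertible) :
    ObtainedBy I (coupledDAE M F) 1
      (fun _ x t => cutsetConstraint M QCRV φ fx fφ (x, t)) := by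
  have hL := ((obtainedBy_inductor (I := I) (M := M) (F := F)).succ
    (contDiff_coupledDAE hM hF)).clm_apply (contDiffOn_inductanceInv hM hwp)
  refine (((obtainedBy_deriv_KCL hI hM hF hQ.CRV_mem_C).sub
    (hL.clm (mulVecCLM (QCRVᵀ * G.A .L)))).sub
    ((obtainedBy_current hM hF hφ hel hinv).clm (mulVecCLM (QCRVᵀ * G.A .lam)))).congr
    fun y x t ht => ?_
  have h1 : inductanceInv M (x, t) (fderiv ℝ M.φL (x.2.1, t) (y.2.1, 0)) = y.2.1 :=
    (hwp.posDef_fderiv_φL hM x.2.1 ht).isInvertible.inverse_apply_self y.2.1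
  have h2 : inductanceInv M (x, t) (fderiv ℝ M.φL (x.2.1, t) (y.2.1, 1) - (G.A .L)ᵀ *ᵥ x.1)
      = y.2.1 - inductanceInv M (x, t)
        ((G.A .L)ᵀ *ᵥ x.1 - fderiv ℝ M.φL (x.2.1, t) (0, 1)) := by
    rw [fderiv_apply_split _ y.2.1 1, add_sub_assoc, map_add, h1, ← neg_sub, map_neg]
    exact (sub_eq_add_neg _ _).symm
  simp only [cutsetConstraint, rateArg_apply, mulVecCLM_apply, dStaticKCL, linCurrents_apply,
    add_apply, ContinuousLinearMap.comp_apply, ContinuousLinearMap.coe_fst',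
    ContinuousLinearMap.coe_snd', branchArg_apply]
  rw [h2]
  simp only [Matrix.mulVec_add, Matrix.mulVec_sub, ← Matrix.mulVec_mulVec,
    transpose_mulVec_eq_zero hQ.CRV_mem_R, transpose_mulVec_eq_zero hQ.CRV_mem_V]
  abel

theorem obtainedBy_loopConstraint (hI : UniqueDiffOn ℝ I) (hM : M.IsSmooth)
    (hwp : M.WellPosed I) (hQ : CircuitProjectors G QC QCRV QVC) (hF : ContDiff ℝ ∞ F) :
    ObtainedBy I (coupledDAE M F) 1 (fun _ x t => loopConstraint M QC QVC (x, t)) := by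
  have hC := ((obtainedBy_KCL (I := I) (M := M) (F := F)).succ
    (contDiff_coupledDAE hM hF)).clm_apply (contDiffOn_capacitiveInv hM hwp hQ)
  refine (((obtainedBy_deriv_source hI hM hF).clm (mulVecCLM QVCᵀ)).sub
    (hC.clm (mulVecCLM (QVCᵀ * (G.A .V)ᵀ)))).congr fun y x t ht => ?_
  have h1 : capacitiveInv M QC (x, t)
      (G.A .C *ᵥ fderiv ℝ M.q ((G.A .C)ᵀ *ᵥ x.1, t) ((G.A .C)ᵀ *ᵥ y.1, 0)) = y.1 - QC *ᵥ y.1 :=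
    nodalOp_inverse_apply (hwp.posDef_fderiv_q hM _ ht) hQ.C_id hQ.C_mem y.1
  simp only [loopConstraint, mulVecCLM_apply]
  rw [fderiv_apply_split _ ((G.A .C)ᵀ *ᵥ y.1) 1, Matrix.mulVec_add, add_assoc, map_add, h1,
    map_neg]
  simp only [Matrix.mulVec_add, Matrix.mulVec_sub, Matrix.mulVec_neg, ← Matrix.mulVec_mulVec,
    hQ.transpose_V_mulVec]
  abel

theorem hasDerivAt_line {E : Type*} [NormedAddCommGroup E] [NormedSpace ℝ E] (a b : E) :
    HasDerivAt (fun σ : ℝ => a + σ • b) b 0 := by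
  simpa using ((hasDerivAt_id (0 : ℝ)).smul_const b).const_add a

/-- The derivative of the cutset constraint in the direction of index-2 components does not see the
currents of the voltage sources, and involves the positive definite operators `(∂φ_L/∂i_L)⁻¹` and
`∂/∂v_λ` of the current rate. -/
theorem hasDerivAt_cutsetConstraint (hφ : ContDiff ℝ ∞ φ)
    (hfx : ContDiff ℝ ∞ fx) (hfφ : ContDiff ℝ ∞ fφ)
    (hinv : ∀ i x, ∀ t ∈ I, (dphi_di φ i x t).IsInvertible) (x : CoupledState G δ) {t : ℝ}
    (ht : t ∈ I) (a : ν → ℝ) (j : G.Br .V → ℝ) :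
    HasDerivAt (fun σ : ℝ => cutsetConstraint M QCRV φ fx fφ (x + σ • (a, 0, j, 0, 0), t))
      (QCRVᵀ *ᵥ (G.A .L *ᵥ inductanceInv M (x, t) ((G.A .L)ᵀ *ᵥ a)
        + G.A .lam *ᵥ fderiv ℝ (fun v => currentRate φ fx fφ x.2.2.2.1 x.2.2.2.2 v t)
          ((G.A .lam)ᵀ *ᵥ x.1) ((G.A .lam)ᵀ *ᵥ a))) 0 := by
  have hrate : ContDiff ℝ ∞ (fun v => currentRate φ fx fφ x.2.2.2.1 x.2.2.2.2 v t) :=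
    contDiffOn_univ.1 ((contDiffOn_currentRate hφ hfx hfφ hinv).comp
      (f := fun v => (x.2.2.2.1, x.2.2.2.2, v, t)) (by fun_prop) fun v _ => ht)
  have hline : ∀ k, HasDerivAt (fun σ : ℝ => (G.A k)ᵀ *ᵥ (x.1 + σ • a)) ((G.A k)ᵀ *ᵥ a) 0 :=
    fun k => (mulVecCLM (G.A k)ᵀ).hasFDerivAt.comp_hasDerivAt 0 (hasDerivAt_line x.1 a)
  have h1 : HasDerivAt (fun σ : ℝ => inductanceInv M (x, t)
      ((G.A .L)ᵀ *ᵥ (x.1 + σ • a) - fderiv ℝ M.φL (x.2.1, t) (0, 1)))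
      (inductanceInv M (x, t) ((G.A .L)ᵀ *ᵥ a)) 0 :=
    (inductanceInv M (x, t)).hasFDerivAt.comp_hasDerivAt 0 ((hline .L).sub_const _)
  have h2 : HasDerivAt (fun σ : ℝ => currentRate φ fx fφ x.2.2.2.1 x.2.2.2.2
      ((G.A .lam)ᵀ *ᵥ (x.1 + σ • a)) t)
      (fderiv ℝ (fun v => currentRate φ fx fφ x.2.2.2.1 x.2.2.2.2 v t)
        ((G.A .lam)ᵀ *ᵥ x.1) ((G.A .lam)ᵀ *ᵥ a)) 0 := by
    have hd := (hrate.differentiable (by simp)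
      ((G.A .lam)ᵀ *ᵥ (x.1 + (0 : ℝ) • a))).hasFDerivAt.comp_hasDerivAt 0 (hline .lam)
    rw [zero_smul, add_zero] at hd
    exact hd
  have h3 := (mulVecCLM QCRVᵀ).hasFDerivAt.comp_hasDerivAt (0 : ℝ)
    ((((mulVecCLM (G.A .L)).hasFDerivAt.comp_hasDerivAt (0 : ℝ) h1).add
      ((mulVecCLM (G.A .lam)).hasFDerivAt.comp_hasDerivAt (0 : ℝ) h2)).add_const
        (G.A .I *ᵥ fderiv ℝ M.isrc t 1))
  refine h3.congr_of_eventuallyEq (Filter.Eventually.of_forall fun σ => ?_)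
  simp [cutsetConstraint, rateArg_apply, inductanceInv]

theorem hasDerivAt_loopConstraint (x : CoupledState G δ) (t : ℝ) (j : G.Br .V → ℝ) :
    HasDerivAt (fun σ : ℝ => loopConstraint M QC QVC (x + σ • (0, 0, j, 0, 0), t))
      (-(QVCᵀ *ᵥ ((G.A .V)ᵀ *ᵥ capacitiveInv M QC (x, t) (G.A .V *ᵥ j)))) 0 := by
  have h0 : HasDerivAt (fun σ : ℝ =>
      -(G.A .C *ᵥ fderiv ℝ M.q ((G.A .C)ᵀ *ᵥ x.1, t) (0, 1) + staticKCL M (x, t)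
        + σ • (G.A .V *ᵥ j))) (-(G.A .V *ᵥ j)) 0 := (hasDerivAt_line _ _).neg
  have h1 := (mulVecCLM QVCᵀ).hasFDerivAt.comp_hasDerivAt (0 : ℝ)
    (((mulVecCLM (G.A .V)ᵀ).hasFDerivAt.comp_hasDerivAt (0 : ℝ)
      ((capacitiveInv M QC (x, t)).hasFDerivAt.comp_hasDerivAt (0 : ℝ) h0)).sub_const
        (fderiv ℝ M.vsrc t 1))
  refine (h1.congr_of_eventuallyEq (Filter.Eventually.of_forall fun σ => ?_)).congr_deriv ?_
  · have h2 : staticKCL M (x + σ • ((0, 0, j, 0, 0) : CoupledState G δ), t)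
        = staticKCL M (x, t) + σ • (G.A .V *ᵥ j) := by
      simp only [staticKCL, linCurrents_apply, Prod.fst_add, Prod.snd_add, Prod.smul_mk,
        smul_zero, add_zero, Matrix.mulVec_add, Matrix.mulVec_smul]
      abel
    have h3 : (x + σ • ((0, 0, j, 0, 0) : CoupledState G δ)).1 = x.1 := by simp
    simp only [loopConstraint, h2, capacitiveInv, h3, Function.comp_apply, mulVecCLM_apply,
      add_assoc]
  · simp [Matrix.mulVec_neg]

/-- The two hidden constraints, differentiated once more, determine the index-2 components. -/
theorem determinedAfter_two (hI : UniqueDiffOn ℝ I) (hM : M.IsSmooth)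
    (hwp : M.WellPosed I) (hQ : CircuitProjectors G QC QCRV QVC)
    (hF : ContDiff ℝ ∞ F) (hφ : ContDiff ℝ ∞ φ) (hfx : ContDiff ℝ ∞ fx) (hfφ : ContDiff ℝ ∞ fφ)
    (hel : ObtainedBy I (elementDAE F) 1 (reducedElementDAE φ fx fφ))
    (hinv : ∀ i x, ∀ t ∈ I, (dphi_di φ i x t).IsInvertible)
    (hpos : ∀ x i v, ∀ t ∈ I, IsPosDefOp (fderiv ℝ (fun v' => currentRate φ fx fφ x i v' t) v)) :
    DeterminedAfter I (coupledDAE M F) 2 (LinearMap.id : CoupledState G δ →ₗ[ℝ] _) := by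
  have hFc := contDiff_coupledDAE hM hF
  have hU : UniqueDiffOn ℝ ((Set.univ : Set (CoupledState G δ)) ×ˢ I) :=
    uniqueDiffOn_univ.prod hI
  obtain ⟨Φ, hΦ, hΦo⟩ := exists_determined_after_one hwp hQ hI hM hF hφ hfx hfφ hel hinv
  set T := componentMap G δ QCRV QVC with hT
  let h : CoupledState G δ × ℝ → (ν → ℝ) × (G.Br .V → ℝ) := fun p =>
    (cutsetConstraint M QCRV φ fx fφ p, loopConstraint M QC QVC p)
  have hh : ContDiffOn ℝ ∞ h (Set.univ ×ˢ I) :=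
    (contDiffOn_cutsetConstraint hM hwp hφ hfx hfφ hinv).prodMk
      (contDiffOn_loopConstraint hM hwp hQ)
  let D : CoupledState G δ × ℝ → CoupledState G δ × ℝ →L[ℝ] (ν → ℝ) × (G.Br .V → ℝ) :=
    fderivWithin ℝ h (Set.univ ×ˢ I)
  have hDs : ContDiffOn ℝ ∞ D (Set.univ ×ˢ I) := hh.fderivWithin hU (by simp)
  have hD : ∀ x, ∀ t ∈ I, HasFDerivWithinAt h (D (x, t)) (Set.univ ×ˢ I) (x, t) := fun x t ht =>
    (hh.differentiableOn (by simp) (x, t) ⟨trivial, ht⟩).hasFDerivWithinAt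
  have hDo : ObtainedBy I (coupledDAE M F) 2 (fun y x t => D (x, t) (y, 1)) :=
    ((obtainedBy_cutsetConstraint hI hM hwp hQ hF hφ hel hinv).prodMk
      (obtainedBy_loopConstraint hI hM hwp hQ hF)).deriv hI hFc (h := h) hD
  -- `x`-derivatives of the constraints, computed along lines on which `t` is constant
  have hDline : ∀ x, ∀ t ∈ I, ∀ y,
      HasDerivAt (fun σ : ℝ => h (x + σ • y, t)) (D (x, t) (y, 0)) 0 := by
    intro x t ht y
    have h1 : HasFDerivWithinAt h (D (x, t)) (Set.univ ×ˢ I) (x + (0 : ℝ) • y, t) := by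
      rw [zero_smul, add_zero]
      exact hD x t ht
    exact hasDerivWithinAt_univ.1 (h1.comp_hasDerivWithinAt (f := fun σ : ℝ => (x + σ • y, t)) 0
      ((hasDerivAt_line x y).prodMk (hasDerivAt_const _ _)).hasDerivWithinAt
      fun σ _ => ⟨trivial, ht⟩)
  have hinj : ∀ x, ∀ t ∈ I, ∀ y, T y = y → D (x, t) (y, 0) = 0 → y = 0 := by
    rintro x t ht ⟨a, iL, j, z, i⟩ hy hDy
    rw [hT, componentMap_apply] at hy
    simp only [Prod.mk.injEq] at hy
    obtain ⟨ha, rfl, hj, rfl, rfl⟩ := hy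
    have hC := hQ.CRV_mem_C a
    have hR := hQ.CRV_mem_R a
    have hV := hQ.CRV_mem_V a
    rw [ha] at hC hR hV
    have h1 : HasDerivAt (fun σ : ℝ =>
        cutsetConstraint M QCRV φ fx fφ (x + σ • ((a, 0, j, 0, 0) : CoupledState G δ), t)) 0 0 :=
      ((ContinuousLinearMap.fst ℝ (ν → ℝ) (G.Br .V → ℝ)).hasFDerivAt.comp_hasDerivAt (0 : ℝ)
        (hDline x t ht (a, 0, j, 0, 0))).congr_deriv (congrArg Prod.fst hDy)
    have h2 := (hasDerivAt_cutsetConstraint (M := M) (QCRV := QCRV) hφ hfx hfφ hinv x ht a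
      j).unique h1
    -- pairing with `a = QCRV a` gives a vanishing sum of two positive definite forms
    have h3 := congrArg (fun v => a ⬝ᵥ v) h2
    simp only [dotProduct_zero] at h3
    rw [dotProduct_mulVec_eq, Matrix.transpose_transpose, ha, dotProduct_add,
      dotProduct_mulVec_eq, dotProduct_mulVec_eq] at h3
    have hLp : IsPosDefOp (inductanceInv M (x, t)) := (hwp.posDef_fderiv_φL hM x.2.1 ht).inverse
    have hrp := hpos x.2.2.2.1 x.2.2.2.2 ((G.A .lam)ᵀ *ᵥ x.1) t ht
    have hL : (G.A .L)ᵀ *ᵥ a = 0 := by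
      refine hLp.eq_zero ?_
      linarith [hrp.nonneg ((G.A .lam)ᵀ *ᵥ a)]
    have hlam : (G.A .lam)ᵀ *ᵥ a = 0 := by
      refine hrp.eq_zero ?_
      linarith [hLp.nonneg ((G.A .L)ᵀ *ᵥ a)]
    have ha0 : a = 0 := by
      have : a ∈ G.nodeKer {.R, .C, .V, .L, .lam} := by
        refine G.mem_nodeKer.2 fun k hk => ?_
        rcases hk with rfl | rfl | rfl | rfl | rfl <;> assumption
      rwa [hwp.no_I_cutset, Submodule.mem_bot] at this
    subst ha0
    have h4 : HasDerivAt (fun σ : ℝ =>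
        loopConstraint M QC QVC (x + σ • ((0, 0, j, 0, 0) : CoupledState G δ), t)) 0 0 :=
      ((ContinuousLinearMap.snd ℝ (ν → ℝ) (G.Br .V → ℝ)).hasFDerivAt.comp_hasDerivAt (0 : ℝ)
        (hDline x t ht (0, 0, j, 0, 0))).congr_deriv (congrArg Prod.snd hDy)
    have h5 := (hasDerivAt_loopConstraint (M := M) (QC := QC) (QVC := QVC) x t j).unique h4
    -- the potentials being zero, the loop constraint gives a positive definite form in `A_V j`
    have h6 := congrArg (fun v => j ⬝ᵥ v) (neg_eq_zero.1 h5)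
    simp only [dotProduct_zero] at h6
    rw [dotProduct_mulVec_eq, Matrix.transpose_transpose, hj, dotProduct_mulVec_eq,
      Matrix.transpose_transpose] at h6
    have hCp : IsPosDefOp (capacitiveInv M QC (x, t)) :=
      (isPosDefOp_nodalOp (hwp.posDef_fderiv_q hM _ ht) hQ.C_id).inverse
    have h7 : G.A .V *ᵥ j = 0 := hCp.eq_zero h6.le
    have h8 : j ∈ LinearMap.ker (G.A .V).mulVecLin := h7
    rw [hwp.no_V_loop, Submodule.mem_bot] at h8
    rw [h8]
    rfl
  let T' : CoupledState G δ →L[ℝ] CoupledState G δ := LinearMap.toContinuousLinearMap T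
  have hS : ContDiffOn ℝ ∞ (fun p => (ContinuousLinearMap.id ℝ (CoupledState G δ) - T').prod
      ((D p).comp (ContinuousLinearMap.inl ℝ _ _))) (Set.univ ×ˢ I) := by
    refine contDiffOn_clm_apply.2 fun y => ?_
    exact contDiffOn_const.prodMk (hDs.clm_apply contDiffOn_const)
  -- `x' - T x'` and the differentiated constraints together determine `x'`
  obtain ⟨Ψ, hΨ, hΨo⟩ := ObtainedBy.exists_determined (T := 0)
    (S := fun p => (ContinuousLinearMap.id ℝ (CoupledState G δ) - T').prod
      ((D p).comp (ContinuousLinearMap.inl ℝ _ _))) (r := fun p => (-Φ p, D p (0, 1)))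
    (((hΦo.succ hFc).prodMk hDo).congr fun y x t ht => by
      rw [fderiv_apply_split _ y 1]
      simp [T', sub_eq_add_neg]) hS
    (hΦ.neg.prodMk (hDs.clm_apply contDiffOn_const)) (fun y => rfl) fun x t ht y => by
      constructor
      · intro hy
        have hy1 : y - T y = 0 := congrArg Prod.fst hy
        have hy2 : D (x, t) (y, 0) = 0 := congrArg Prod.snd hy
        exact (hinj x t ht y (sub_eq_zero.1 hy1).symm hy2).symm
      · intro hy
        have : y = 0 := hy.symm
        rw [this, map_zero]
  exact ⟨Ψ, hΨ.continuousOn, hΨo.congr fun y x t _ => by simp⟩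

end Hidden

/-! ### Perturbing consistent jets -/

section Perturbation

variable {X W U : Type*} [NormedAddCommGroup X] [NormedSpace ℝ X]
  [NormedAddCommGroup W] [NormedSpace ℝ W] [NormedAddCommGroup U] [NormedSpace ℝ U]
  {I : Set ℝ} {F : X → X → ℝ → W}

theorem hasDerivAt_triFun_line (hF : ContDiff ℝ ∞ (triFun F)) (y x : X) (t : ℝ) (b d : X) :
    HasDerivAt (fun σ : ℝ => F (y + σ • b) (x + σ • d) t)
      (fderiv ℝ (triFun F) (y, x, t) (b, d, 0)) 0 := by
  have h1 := (hF.differentiable (by simp) (y + (0 : ℝ) • b, x + (0 : ℝ) • d, t)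
    ).hasFDerivAt.comp_hasDerivAt (0 : ℝ)
    ((hasDerivAt_line y b).prodMk ((hasDerivAt_line x d).prodMk (hasDerivAt_const _ t)))
  simp only [zero_smul, add_zero] at h1
  exact h1

/-- If `F` is affine in the component along `w` of `x`, with coefficient `m`, and does not contain
its derivative, then a change of `x'` by `w` and of `x''` by `b` changes `dF/dt` by
`m + ∂F/∂x' b`. -/
theorem totalDeriv_one_shift (hF : ContDiff ℝ ∞ (triFun F)) {w : X} {m : W}
    (h₁ : ∀ (σ : ℝ) y x t, F (y + σ • w) x t = F y x t)
    (h₂ : ∀ (σ : ℝ) y x t, F y (x + σ • w) t = F y x t + σ • m)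
    (u : Fin 3 → X) (b : X) (σ : ℝ) (t : ℝ) :
    totalDeriv F 1 (u + σ • ![0, w, b]) t =
      totalDeriv F 1 u t + σ • (m + fderiv ℝ (triFun F) (u 1, u 0, t) (b, 0, 0)) := by
  have hshift : fderiv ℝ (triFun F) (u 1 + σ • w, u 0, t)
      = fderiv ℝ (triFun F) (u 1, u 0, t) := by
    have h : triFun F = fun p => triFun F (p + (σ • w, 0, 0)) := by
      funext p
      simp [triFun, h₁]
    conv_rhs => rw [h, fderiv_comp_add_right]
    simp
  have hw : fderiv ℝ (triFun F) (u 1, u 0, t) (0, w, 0) = m := by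
    have h := hasDerivAt_triFun_line hF (u 1) (u 0) t 0 w
    simp only [smul_zero, add_zero, h₂] at h
    exact h.unique (hasDerivAt_line _ _)
  rw [totalDeriv_one hF, totalDeriv_one hF]
  have e0 : (u + σ • ![0, w, b]) 0 = u 0 := by simp
  have e1 : (u + σ • ![0, w, b]) 1 = u 1 + σ • w := by simp
  have e2 : (u + σ • ![0, w, b]) 2 = u 2 + σ • b := by simp
  have e3 : ((u 2 + σ • b, u 1 + σ • w, (1 : ℝ)) : X × X × ℝ)
      = (u 2, u 1, 1) + σ • ((0, w, 0) + (b, 0, 0)) := by simp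
  rw [e0, e1, e2, hshift, e3, map_add, map_smul, map_add, hw]

theorem contDiff_totalDeriv_one (hF : ContDiff ℝ ∞ (triFun F)) (t : ℝ) :
    ContDiff ℝ ∞ (fun u : Fin 3 → X => totalDeriv F 1 u t) := by
  simp only [totalDeriv_one hF]
  exact ((contDiff_fderiv hF).comp (by fun_prop)).clm_apply (by fun_prop)

/-- At a consistent jet, the derivatives of the coefficients of an obtained equation do not
contribute to its derivative. -/
theorem ObtainedBy.exists_hasDerivAt (hF : ContDiff ℝ ∞ (triFun F)) {E : X → X → ℝ → U}
    (h : ObtainedBy I F 1 E) {t : ℝ} (ht : t ∈ I) {u : Fin 3 → X}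
    (hu : ∀ j ≤ 1, totalDeriv F j u t = 0) :
    ∃ r₀ r₁ : W →L[ℝ] U, ∀ (d₁ d₂ : X) (D : W),
      HasDerivAt (fun σ : ℝ => totalDeriv F 1 (u + σ • ![0, d₁, d₂]) t) D 0 →
      HasDerivAt (fun σ : ℝ => E (u 1 + σ • d₁) (u 0) t)
        (r₀ (fderiv ℝ (triFun F) (u 1, u 0, t) (d₁, 0, 0)) + r₁ D) 0 := by
  obtain ⟨R, hR, h⟩ := h
  refine ⟨R 0 (u, t), R 1 (u, t), fun d₁ d₂ D hD => ?_⟩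
  have hRd : ∀ j, ∃ R', HasDerivAt (fun σ : ℝ => R j (u + σ • ![0, d₁, d₂], t)) R' 0 := by
    intro j
    have h1 : ContDiff ℝ ∞ (fun σ : ℝ => R j (u + σ • ![0, d₁, d₂], t)) :=
      contDiffOn_univ.1 ((hR j).comp (f := fun σ : ℝ => (u + σ • ![0, d₁, d₂], t))
        (by fun_prop) fun σ _ => ⟨trivial, ht⟩)
    exact ⟨_, (h1.differentiable (by simp) 0).hasDerivAt⟩
  obtain ⟨R₀', hR₀'⟩ := hRd 0
  obtain ⟨R₁', hR₁'⟩ := hRd 1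
  have e0 : ∀ σ : ℝ, (u + σ • ![0, d₁, d₂]) 0 = u 0 := fun σ => by simp
  have e1 : ∀ σ : ℝ, (u + σ • ![0, d₁, d₂]) 1 = u 1 + σ • d₁ := fun σ => by simp
  have hF0 : HasDerivAt (fun σ : ℝ => totalDeriv F 0 (u + σ • ![0, d₁, d₂]) t)
      (fderiv ℝ (triFun F) (u 1, u 0, t) (d₁, 0, 0)) 0 := by
    have h1 := hasDerivAt_triFun_line hF (u 1) (u 0) t d₁ 0
    refine h1.congr_of_eventuallyEq (Filter.Eventually.of_forall fun σ => ?_)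
    beta_reduce
    rw [totalDeriv_zero, e0, e1, smul_zero, add_zero]
  -- the terms with `R₀'`, `R₁'` vanish since `F` and `dF/dt` vanish at the jet `u`
  have h2 := (hR₀'.clm_apply hF0).add (hR₁'.clm_apply hD)
  simp only [zero_smul, add_zero, hu 0 (by norm_num), hu 1 le_rfl, map_zero, zero_add] at h2
  refine h2.congr_of_eventuallyEq (Filter.Eventually.of_forall fun σ => ?_)
  have h3 := h t ht (u + σ • ![0, d₁, d₂])
  rw [Fin.sum_univ_two, e0, e1] at h3
  exact h3

end Perturbation

/-! ### The voltage coefficient of an inductance-like element -/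

section ElementRange

variable {δ κ : Type*} [Fintype δ] [Fintype κ] {I : Set ℝ} {F : ElementFun δ κ}
  {φ : (κ → ℝ) × (δ → ℝ) × ℝ → (κ → ℝ)}
  {fx : (δ → ℝ) × (κ → ℝ) × (κ → ℝ) × ℝ → (δ → ℝ)}
  {fφ : (δ → ℝ) × (κ → ℝ) × (κ → ℝ) × ℝ → (κ → ℝ)}
  {Ft : (δ → ℝ) × (κ → ℝ) × (δ → ℝ) × (κ → ℝ) × ℝ → (δ ⊕ κ → ℝ)}
  {B : Matrix (δ ⊕ κ) κ ℝ}

theorem hasDerivAt_reducedElementDAE (y d z : (δ → ℝ) × (κ → ℝ) × (κ → ℝ)) (t : ℝ) :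
    HasDerivAt (fun σ : ℝ => reducedElementDAE φ fx fφ (y + σ • d) z t)
      (d.1, fderiv ℝ φ (z.2.1, z.1, t) (d.2.1, d.1, 0)) 0 := by
  refine HasDerivAt.prodMk ((hasDerivAt_line y.1 d.1).sub_const _) (HasDerivAt.sub_const _ ?_)
  refine (fderiv ℝ φ (z.2.1, z.1, t)).hasFDerivAt.comp_hasDerivAt (0 : ℝ) ?_
  exact (hasDerivAt_line y.2.1 d.2.1).prodMk
    ((hasDerivAt_line y.1 d.1).prodMk (hasDerivAt_const _ _))

/-- At a consistent jet, `im B ⊆ im ∂F/∂(x', i')`: a change of `v'` can be compensated by a change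
of `(x'', i'')`. Differentiating the identity `E = R₀ F + R₁ F'` for the reduced system `E` shows
that `R₁` vanishes on `im ∂F/∂(x', i')` and on `im B`; since there are as many equations as
unknowns `(x, i)`, the kernel of `R₁` is not larger than `im ∂F/∂(x', i')`. -/
theorem exists_fderiv_elementDAE_eq (hF : ContDiff ℝ ∞ F)
    (hlin : ∀ (x' : δ → ℝ) (i' : κ → ℝ) (x : δ → ℝ) (i v : κ → ℝ) (t : ℝ),
      F (x', i', x, i, v, t) = Ft (x', i', x, i, t) + B *ᵥ v)
    (hφ : ContDiff ℝ ∞ φ)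
    (hel : ObtainedBy I (elementDAE F) 1 (reducedElementDAE φ fx fφ))
    (hinv : ∀ i x, ∀ t ∈ I, (dphi_di φ i x t).IsInvertible)
    {t : ℝ} (ht : t ∈ I) {u : Fin 3 → (δ → ℝ) × (κ → ℝ) × (κ → ℝ)}
    (hu : ∀ j ≤ 1, totalDeriv (elementDAE F) j u t = 0) (v : κ → ℝ) :
    ∃ a : (δ → ℝ) × (κ → ℝ),
      fderiv ℝ (triFun (elementDAE F)) (u 1, u 0, t) ((a.1, a.2, 0), 0, 0) = B *ᵥ v := by
  have hE := contDiff_elementDAE hF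
  obtain ⟨r₀, r₁, hr⟩ := hel.exists_hasDerivAt hE ht hu
  let ε : (δ → ℝ) × (κ → ℝ) →L[ℝ] (δ → ℝ) × (κ → ℝ) × (κ → ℝ) :=
    (ContinuousLinearMap.fst ℝ _ _).prod ((ContinuousLinearMap.snd ℝ _ _).prod 0)
  let f : (δ → ℝ) × (κ → ℝ) →L[ℝ] (δ ⊕ κ → ℝ) :=
    (fderiv ℝ (triFun (elementDAE F)) (u 1, u 0, t)).comp
      ((ContinuousLinearMap.inl ℝ _ _).comp ε)
  let G := fderiv ℝ (fun u => totalDeriv (elementDAE F) 1 u t) u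
  let mid : (δ → ℝ) × (κ → ℝ) × (κ → ℝ) →L[ℝ] (Fin 3 → (δ → ℝ) × (κ → ℝ) × (κ → ℝ)) :=
    ContinuousLinearMap.pi ![0, ContinuousLinearMap.id ℝ _, 0]
  have hmid : ∀ d, mid d = ![0, d, 0] := by
    intro d
    funext k
    fin_cases k <;> rfl
  let g : (δ → ℝ) × (κ → ℝ) →L[ℝ] (δ ⊕ κ → ℝ) := G.comp (mid.comp ε)
  -- variation of `(x'', i'')`
  have hf : ∀ a : (δ → ℝ) × (κ → ℝ), r₁ (f a) = 0 := by
    intro a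
    have h1 : HasDerivAt (fun σ : ℝ => totalDeriv (elementDAE F) 1 (u + σ • ![0, 0, ε a]) t)
        (f a) 0 := by
      have h2 := totalDeriv_one_shift hE (w := 0) (m := 0) (fun σ y x t => by simp)
        (fun σ y x t => by simp) u (ε a)
      simp only [h2, zero_add]
      exact hasDerivAt_line _ _
    have h3 := (hr 0 (ε a) _ h1).unique (hasDerivAt_reducedElementDAE (u 1) 0 (u 0) t)
    have h4 : ((0 : (δ → ℝ) × (κ → ℝ) × (κ → ℝ)), (0 : (δ → ℝ) × (κ → ℝ) × (κ → ℝ)), (0 : ℝ))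
      = 0 := rfl
    simpa [h4, Prod.mk_zero_zero] using h3
  -- variation of `(x', i')`, in which the reduced system has an invertible coefficient
  have hg : ∀ a : (δ → ℝ) × (κ → ℝ), r₀ (f a) + r₁ (g a) = 0 → a = 0 := by
    intro a ha
    have h1 : HasDerivAt (fun σ : ℝ => totalDeriv (elementDAE F) 1 (u + σ • ![0, ε a, 0]) t)
        (g a) 0 := by
      have h2 := ((contDiff_totalDeriv_one hE t).differentiable (by simp)
        (u + (0 : ℝ) • mid (ε a))).hasFDerivAt.comp_hasDerivAt (0 : ℝ)
        (hasDerivAt_line u (mid (ε a)))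
      rw [zero_smul, add_zero] at h2
      rw [← hmid]
      exact h2
    have h3 := (hr (ε a) 0 _ h1).unique (hasDerivAt_reducedElementDAE (u 1) (ε a) (u 0) t)
    have h4 : ((ε a).1, fderiv ℝ φ ((u 0).2.1, (u 0).1, t) ((ε a).2.1, (ε a).1, 0)) = 0 :=
      h3.symm.trans ha
    obtain ⟨a₁, a₂⟩ := a
    have h5 : a₁ = 0 := congrArg Prod.fst h4
    subst h5
    have h6 : fderiv ℝ φ ((u 0).2.1, (u 0).1, t) (a₂, 0, 0) = 0 := congrArg Prod.snd h4
    have h7 : dphi_di φ (u 0).2.1 (u 0).1 t a₂ = 0 := by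
      rw [dphi_di_eq hφ]
      exact h6
    have h8 : a₂ = 0 := (hinv _ _ t ht).injective (h7.trans (map_zero _).symm)
    rw [h8]
    rfl
  -- variation of `v'`, which the reduced system does not contain
  have hB : r₁ (B *ᵥ v) = 0 := by
    have h1 : HasDerivAt (fun σ : ℝ => totalDeriv (elementDAE F) 1 (u + σ • ![0, (0, 0, v), 0]) t)
        (B *ᵥ v) 0 := by
      have h2 := totalDeriv_one_shift hE (w := (0, 0, v)) (m := B *ᵥ v)
        (fun σ y x t => by simp [elementDAE])
        (fun σ y x t => by simp [elementDAE, hlin, Matrix.mulVec_add, Matrix.mulVec_smul,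
          add_assoc]) u 0
      have h4 : ((0 : (δ → ℝ) × (κ → ℝ) × (κ → ℝ)), (0 : (δ → ℝ) × (κ → ℝ) × (κ → ℝ)), (0 : ℝ))
        = 0 := rfl
      simp only [h2, h4, map_zero, add_zero]
      exact hasDerivAt_line _ _
    have h3 := (hr (0, 0, v) 0 _ h1).unique
      (hasDerivAt_reducedElementDAE (u 1) (0, 0, v) (u 0) t)
    have h5 : fderiv ℝ (triFun (elementDAE F)) (u 1, u 0, t) ((0, 0, v), 0, 0) = 0 := by
      have h6 := hasDerivAt_triFun_line hE (u 1) (u 0) t (0, 0, v) 0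
      refine h6.unique ((hasDerivAt_const (0 : ℝ) (elementDAE F (u 1) (u 0) t)
        ).congr_of_eventuallyEq (Filter.Eventually.of_forall fun σ => ?_))
      simp [elementDAE]
    have h7 : ((0 : κ → ℝ), (0 : δ → ℝ), (0 : ℝ)) = 0 := rfl
    simp only [h5, map_zero, zero_add, h7] at h3
    exact h3
  have hdim : Module.finrank ℝ ((δ → ℝ) × (κ → ℝ)) = Module.finrank ℝ (δ ⊕ κ → ℝ) := by
    simp
  obtain ⟨a, ha⟩ := ker_le_range_of_injective hdim (f := f.toLinearMap) (g := g.toLinearMap)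
    (r₀ := r₀.toLinearMap) (r := r₁.toLinearMap) hf hg (show B *ᵥ v ∈ LinearMap.ker _ from hB)
  exact ⟨a, ha⟩

end ElementRange

/-! ### Components not determined after one differentiation -/

section Undetermined

variable {ν β δ : Type*} [Fintype ν] [DecidableEq ν] [Fintype β] [Fintype δ]
  {G : CircuitGraph ν β} {M : CircuitModel G} {F : ElementFun δ (G.Br .lam)} {I : Set ℝ}
  {QC QCRV : Matrix ν ν ℝ} {QVC : Matrix (G.Br .V) (G.Br .V) ℝ}

theorem fderiv_coupledDAE_apply (hM : M.IsSmooth) (hF : ContDiff ℝ ∞ F) (y x b : CoupledState G δ)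
    (t : ℝ) : fderiv ℝ (triFun (coupledDAE M F)) (y, x, t) (b, 0, 0) =
      (G.A .C *ᵥ fderiv ℝ M.q ((G.A .C)ᵀ *ᵥ x.1, t) ((G.A .C)ᵀ *ᵥ b.1, 0),
        fderiv ℝ M.φL (x.2.1, t) (b.2.1, 0), 0,
        fderiv ℝ (triFun (elementDAE F)) (elementProj G δ y, elementProj G δ x, t)
          (elementProj G δ b, 0, 0)) := by
  have h1 := hasDerivAt_triFun_line (contDiff_coupledDAE hM hF) y x t b 0
  refine h1.unique ?_
  simp only [smul_zero, add_zero, coupledDAE_apply]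
  refine HasDerivAt.prodMk (HasDerivAt.add_const _ ?_) (HasDerivAt.prodMk
    (HasDerivAt.sub_const _ ?_) (HasDerivAt.prodMk (hasDerivAt_const _ _) ?_))
  · refine (mulVecCLM (G.A .C)).hasFDerivAt.comp_hasDerivAt (0 : ℝ)
      ((fderiv ℝ M.q _).hasFDerivAt.comp_hasDerivAt (0 : ℝ)
        (HasDerivAt.prodMk ?_ (hasDerivAt_const _ _)))
    exact (mulVecCLM (G.A .C)ᵀ).hasFDerivAt.comp_hasDerivAt (0 : ℝ) (hasDerivAt_line y.1 b.1)
  · exact (fderiv ℝ M.φL _).hasFDerivAt.comp_hasDerivAt (0 : ℝ)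
      ((hasDerivAt_line y.2.1 b.2.1).prodMk (hasDerivAt_const _ _))
  · have h2 := hasDerivAt_triFun_line (contDiff_elementDAE hF) (elementProj G δ y)
      (elementProj G δ x) t (elementProj G δ b) 0
    refine h2.congr_of_eventuallyEq (Filter.Eventually.of_forall fun σ => ?_)
    simp [elementDAE, elementProj_apply]

/-- At a consistent jet, a change of `x'` along `QCRV e`, `QVC i_V` can be compensated by a change
of `x''`: these components are not determined after one differentiation. -/
theorem comp_componentMap_eq_zero_of_determinedAfter_one (hM : M.IsSmooth) (hwp : M.WellPosed I)
    (hQ : CircuitProjectors G QC QCRV QVC) (hF : ContDiff ℝ ∞ F) (hind : IsInductanceLike I F)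
    {Ft : (δ → ℝ) × (G.Br .lam → ℝ) × (δ → ℝ) × (G.Br .lam → ℝ) × ℝ → (δ ⊕ G.Br .lam → ℝ)}
    {B : Matrix (δ ⊕ G.Br .lam) (G.Br .lam) ℝ}
    (hlin : ∀ (x' : δ → ℝ) (i' : G.Br .lam → ℝ) (x : δ → ℝ) (i v : G.Br .lam → ℝ) (t : ℝ),
      F (x', i', x, i, v, t) = Ft (x', i', x, i, t) + B *ᵥ v)
    (hcons : ConsistentToOrder I (coupledDAE M F) 1) {ℓ : CoupledState G δ →ₗ[ℝ] ℝ}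
    (hℓ : DeterminedAfter I (coupledDAE M F) 1 ℓ) : ℓ ∘ₗ componentMap G δ QCRV QVC = 0 := by
  obtain ⟨φ, fx, fφ, hφ, hfx, hfφ, hel, hinv, -⟩ := hind
  obtain ⟨Φ, -, R, -, hR⟩ := hℓ
  obtain ⟨t, ht, u, hu⟩ := hcons
  have hFc := contDiff_coupledDAE hM hF
  have hE := contDiff_elementDAE hF
  refine LinearMap.ext fun z => ?_
  set T := componentMap G δ QCRV QVC with hT
  have hshift := coupledDAE_sub_componentMap (M := M) hlin hQ
  rw [← hT] at hshift
  have hTT := hQ.componentMap_idem (δ := δ)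
  rw [← hT] at hTT
  have h₁ : ∀ (σ : ℝ) y x t, coupledDAE M F (y + σ • T z) x t = coupledDAE M F y x t := by
    intro σ y x t
    rw [hshift, hshift y x t]
    simp [hTT]
  have h₂ : ∀ (σ : ℝ) y x t, coupledDAE M F y (x + σ • T z) t
      = coupledDAE M F y x t + σ • componentCoeff G δ B (T z) := by
    intro σ y x t
    rw [hshift, hshift y x t]
    simp [hTT, add_assoc]
  obtain ⟨b, hb⟩ : ∃ b, fderiv ℝ (triFun (coupledDAE M F)) (u 1, u 0, t) (b, 0, 0)
      = -componentCoeff G δ B (T z) := by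
    obtain ⟨a, ha⟩ := exists_fderiv_elementDAE_eq hF hlin hφ hel hinv ht
      (u := fun i => elementProj G δ (u i))
      (fun j hj => by
        rw [totalDeriv_map hFc (elementProj G δ) ((ContinuousLinearMap.snd ℝ _ _).comp
          ((ContinuousLinearMap.snd ℝ _ _).comp (ContinuousLinearMap.snd ℝ _ _)))
          (fun y x t => by rw [coupledDAE_apply]; rfl), hu j hj, map_zero])
      (-((G.A .lam)ᵀ *ᵥ (QCRV *ᵥ z.1)))
    obtain ⟨bL, hbL⟩ := (hwp.posDef_fderiv_φL hM (u 0).2.1 ht).isInvertible.surjective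
      ((G.A .L)ᵀ *ᵥ (QCRV *ᵥ z.1))
    obtain ⟨be, hbe⟩ := exists_nodal_preimage
      (hwp.posDef_fderiv_q hM ((G.A .C)ᵀ *ᵥ (u 0).1) ht) hQ.C_id hQ.C_mem
      (z := -(G.A .V *ᵥ (QVC *ᵥ z.2.2.1))) (by rw [Matrix.mulVec_neg, hQ.V_mem, neg_zero])
    refine ⟨(be, bL, 0, a.1, a.2), ?_⟩
    rw [fderiv_coupledDAE_apply hM hF, hT, componentMap_apply, componentCoeff_apply]
    have hv : fderiv ℝ (triFun (elementDAE F)) (elementProj G δ (u 1), elementProj G δ (u 0), t)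
        ((0, 0, (G.A .lam)ᵀ *ᵥ be), 0, 0) = 0 := by
      have h6 := hasDerivAt_triFun_line hE (elementProj G δ (u 1)) (elementProj G δ (u 0)) t
        (0, 0, (G.A .lam)ᵀ *ᵥ be) 0
      refine h6.unique ((hasDerivAt_const (0 : ℝ) (elementDAE F (elementProj G δ (u 1))
        (elementProj G δ (u 0)) t)).congr_of_eventuallyEq
        (Filter.Eventually.of_forall fun σ => ?_))
      simp [elementDAE]
    refine Prod.ext hbe (Prod.ext (hbL.trans (neg_neg _).symm) (Prod.ext neg_zero.symm ?_))
    have h7 : ((elementProj G δ (be, bL, 0, a.1, a.2), 0, 0) : _ × _ × ℝ)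
        = (((a.1, a.2, 0), 0, 0) : ((δ → ℝ) × (G.Br .lam → ℝ) × (G.Br .lam → ℝ)) ×
          ((δ → ℝ) × (G.Br .lam → ℝ) × (G.Br .lam → ℝ)) × ℝ)
          + ((0, 0, (G.A .lam)ᵀ *ᵥ be), 0, 0) := by
      simp [elementProj_apply]
    change fderiv ℝ (triFun (elementDAE F)) (elementProj G δ (u 1), elementProj G δ (u 0), t)
      (elementProj G δ (be, bL, 0, a.1, a.2), 0, 0) = -(B *ᵥ ((G.A .lam)ᵀ *ᵥ (QCRV *ᵥ z.1)))
    rw [h7, map_add, hv, add_zero, ha, Matrix.mulVec_neg]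
  -- the perturbed jet is consistent again, with the same `x` and with `x'` changed by `T z`
  have h3 := totalDeriv_one_shift hFc h₁ h₂ u b 1 t
  rw [hb, add_neg_cancel, smul_zero, add_zero, hu 1 le_rfl, one_smul] at h3
  have h4 : totalDeriv (coupledDAE M F) 0 (u + ![0, T z, b]) t = 0 := by
    have h5 := h₁ 1 (u 1) (u 0) t
    have h6 := hu 0 (by norm_num)
    rw [totalDeriv_zero] at h6 ⊢
    rw [one_smul] at h5
    simpa [h6] using h5
  have h5 := hR t ht u
  have h6 := hR t ht (u + ![0, T z, b])
  rw [Fin.sum_univ_two] at h5 h6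
  simp only [Fin.val_zero, Fin.val_one, hu 0 (by norm_num), hu 1 le_rfl, map_zero, add_zero] at h5
  simp only [Fin.val_zero, Fin.val_one, h3, h4, map_zero, add_zero] at h6
  have e0 : (u + ![0, T z, b]) 0 = u 0 := by simp
  have e1 : (u + ![0, T z, b]) 1 = u 1 + T z := by simp
  rw [e0, e1, map_add] at h6
  change ℓ (T z) = 0
  linarith

end Undetermined

theorem mainTheorem6 {ν β δ : Type*} [Fintype ν] [DecidableEq ν] [Fintype β] [Fintype δ]
    (t₀ t₁ : ℝ) (ht : t₀ < t₁)
    (G : CircuitGraph ν β) (M : CircuitModel G)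
    (hsmooth : M.IsSmooth) (hwp : M.WellPosed (Set.Icc t₀ t₁))
    -- the inductance-like element, whose DAE is linear in the branch voltage
    (F : ElementFun δ (G.Br .lam)) (hF : ContDiff ℝ ∞ F)
    (hind : IsInductanceLike (Set.Icc t₀ t₁) F)
    (Ft : (δ → ℝ) × (G.Br .lam → ℝ) × (δ → ℝ) × (G.Br .lam → ℝ) × ℝ → (δ ⊕ G.Br .lam → ℝ))
    (B : Matrix (δ ⊕ G.Br .lam) (G.Br .lam) ℝ)
    (hlin : ∀ (x' : δ → ℝ) (i' : G.Br .lam → ℝ) (x : δ → ℝ) (i v : G.Br .lam → ℝ) (t : ℝ),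
      F (x', i', x, i, v, t) = Ft (x', i', x, i, t) + B *ᵥ v)
    (hcut : G.LiesInLILamCutset)
    (hcons : ConsistentToOrder (Set.Icc t₀ t₁) (coupledDAE M F) 1)
    -- projectors onto the three kernels
    (QC QCRV : Matrix ν ν ℝ) (QVC : Matrix (G.Br .V) (G.Br .V) ℝ)
    (hQC : LinearMap.IsProj (G.nodeKer {.C}) QC.mulVecLin)
    (hQCRV : LinearMap.IsProj (G.nodeKer {.C, .R, .V}) QCRV.mulVecLin)
    (hQVC : LinearMap.IsProj (LinearMap.ker (QCᵀ * G.A .V).mulVecLin) QVC.mulVecLin) :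
    HasLinearIndexTwoComponents (Set.Icc t₀ t₁) (coupledDAE M F)
      (componentMap G δ QCRV QVC) := by
  have hQ := CircuitProjectors.of_isProj hQC hQCRV hQVC
  have hI : UniqueDiffOn ℝ (Set.Icc t₀ t₁) := uniqueDiffOn_Icc ht
  have hFc := contDiff_coupledDAE hsmooth hF
  have hneg : ∀ ℓ : CoupledState G δ →ₗ[ℝ] ℝ,
      DeterminedAfter (Set.Icc t₀ t₁) (coupledDAE M F) 1 ℓ →
      ℓ ∘ₗ componentMap G δ QCRV QVC = 0 := fun ℓ hℓ =>
    comp_componentMap_eq_zero_of_determinedAfter_one hsmooth hwp hQ hF hind hlin hcons hℓ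
  obtain ⟨φ, fx, fφ, hφ, hfx, hfφ, hel, hinv, hpos⟩ := hind
  have hone : ¬ DeterminedAfter (Set.Icc t₀ t₁) (coupledDAE M F) 1
      (LinearMap.id : CoupledState G δ →ₗ[ℝ] _) := by
    rintro ⟨Φ, hΦ, hobt⟩
    obtain ⟨w, hw, hw0⟩ := Submodule.exists_mem_ne_zero_of_ne_bot
      (G.nodeKer_ne_bot_of_liesInLILamCutset hcut)
    -- a node potential of `w ∈ im QCRV` would be determined, contrary to `hneg`
    obtain ⟨n, hn⟩ := Function.ne_iff.1 hw0
    let ℓ : CoupledState G δ →L[ℝ] ℝ :=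
      (ContinuousLinearMap.proj n).comp (ContinuousLinearMap.fst ℝ (ν → ℝ) _)
    have h1 := hneg ℓ.toLinearMap ⟨fun p => ℓ (Φ p), ℓ.continuous.comp_continuousOn hΦ,
      (hobt.clm ℓ).congr fun y x t _ => by simp⟩
    have h2 : (QCRV *ᵥ w) n = 0 := LinearMap.congr_fun h1 ((w, 0, 0, 0, 0) : CoupledState G δ)
    have h3 : QCRV *ᵥ w = w := hQCRV.map_id w hw
    rw [h3] at h2
    exact hn h2
  refine ⟨⟨?_, ⟨?_, ?_⟩, fun ℓ => ⟨hneg ℓ, fun hℓ => ?_⟩⟩, componentCoeff G δ B,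
    fun y x t _ => coupledDAE_sub_componentMap hlin hQ y x t⟩
  · exact LinearMap.ext fun z => hQ.componentMap_idem z
  · exact determinedAfter_two hI hsmooth hwp hQ hF hφ hfx hfφ hel hinv hpos
  · intro k hk
    by_contra! hlt
    obtain rfl | rfl : k = 0 ∨ k = 1 := by omega
    · obtain ⟨Φ, hΦ, hobt⟩ := hk
      exact hone ⟨Φ, hΦ, hobt.succ hFc⟩
    · exact hone hk
  · obtain ⟨Φ, hΦ, hobt⟩ :=
      exists_determined_after_one hwp hQ hI hsmooth hF hφ hfx hfφ hel hinv
    let L : CoupledState G δ →L[ℝ] ℝ := LinearMap.toContinuousLinearMap ℓ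
    refine ⟨fun p => L (Φ p), L.continuous.comp_continuousOn hΦ.continuousOn,
      (hobt.clm L).congr fun y x t _ => ?_⟩
    have h1 : ℓ (componentMap G δ QCRV QVC y) = 0 := LinearMap.congr_fun hℓ y
    simp [L, h1]
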